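/- Let $a,b,c$ be real polynomials and $\alpha>0$ with $a(x)\ge\alpha$ for $x\in[0,1]$. For functions $M,K_1,K_2$ put $$(\mathcal X_{\{M,K_1,K_2\}}w)(x)=M(x)w(x)+\int_0^xK_1(x,\xi)w(\xi)\,d\xi+\int_x^1K_2(x,\xi)w(\xi)\,d\xi .$$ Let $Z_d(x)$ and $Z_d(x,\xi)$ be the column vectors of all monomials of degree at most $d$ in $x$, respectively in $(x,\xi)$, the entry $1$ first. For $\epsilon\ge 0$ and $d_1,d_2\in\mathbb N$, with $Z_1=Z_{d_1}$ and $Z_2=Z_{d_2}$, write $\{M,K_1,K_2\}\in\Xi_{d_1,d_2,\epsilon}$ if there are real matrices $P_{ij}$, $1\le i,j\le 3$, with $P_{ji}=P_{ij}^T$, such that the block matrix $(P_{ij})$ with $\epsilon$ subtracted from the $(1,1)$ entry of $P_{11}$ is positive semidefinite, and for all $x,\xi$ $$M(x)=Z_1(x)^TP_{11}Z_1(x),\qquad K_2(x,\xi)=K_1(\xi,x),$$ $$K_1(x,\xi)=Z_1(x)^TP_{12}Z_2(x,\xi)+Z_2(\xi,x)^TP_{31}Z_1(\xi)+\int_0^\xi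 Z_2(\eta,x)^TP_{33}Z_2(\eta,\xi)\,d\eta+\int_\xi^xZ_2(\eta,x)^TP_{32}Z_2(\eta,\xi)\,d\eta+\int_x^1Z_2(\eta,x)^TP_{22}Z_2(\eta,\xi)\,d\eta .$$ Let $\epsilon,\delta>0$, $d_1,d_2,\hat d_1,\hat d_2\in\mathbb N$, and let $M,K_1,K_2$ be polynomials with $\{M,K_1,K_2\}\in\Xi_{d_1,d_2,\epsilon}$ and $K_2(0,x)=0$. Let $\{\hat M,\hat K_1,\hat K_2\}=\Omega_s(M,K_1,K_2)$, that is, $$\hat M(x)=\partial_x\big[\partial_x[a(x)M(x)]-b(x)M(x)\big]+2\big[\partial_x[a(x)(K_1(x,\xi)-K_2(x,\xi))]\big]_{\xi=x}+2M(x)c(x)-\tfrac{\pi^2}{2}\alpha\epsilon,$$ $$\hat K_1(x,\xi)=\partial_x\big[\partial_x[a(x)K_1(x,\xi)]-b(x)K_1(x,\xi)\big]+\partial_\xi\big[\partial_\xi[a(\xi)K_1(x,\xi)]-b(\xi)K_1(x,\xi)\big]+(c(x)+c(\xi))K_1(x,\xi),$$ $$\hat K_2(x,\xi)=\hat K_1(\xi,x),$$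 and suppose $$\{-\hat M-2\delta M,\;-\hat K_1-2\delta K_1,\;-\hat K_2-2\delta K_2\}\in\Xi_{\hat d_1,\hat d_2,0}.$$ Write $K_1(x,\xi)=F(x)^TG(\xi)$ with vectors $F,G$ of polynomials of equal length, and let $$B=\begin{bmatrix}G\\F\end{bmatrix},\quad C=\begin{bmatrix}F^T&-G^T\end{bmatrix},\quad N_1=\begin{bmatrix}I&0\\0&0\end{bmatrix},\quad N_2=\begin{bmatrix}0&0\\0&I\end{bmatrix},$$ $U=\lim_nU_n$ with $U_1=I$, $U_{n+1}(x)=I-\int_0^xB(\xi)M(\xi)^{-1}C(\xi)U_n(\xi)\,d\xi$, $H=[N_1+N_2U(1)]^{-1}N_2U(1)$, and $$\underline M(x)=M(x)^{-1},\qquad \underline K_1(x,\xi)=M(x)^{-1}C(x)U(x)(H-I)U(\xi)^{-1}B(\xi)M(\xi)^{-1},\qquad \underline K_2(x,\xi)=M(x)^{-1}C(x)U(x)HU(\xi)^{-1}B(\xi)M(\xi)^{-1}$$ (these are the multiplier and the kernels of $\mathcal X_{\{M,K_1,K_2\}}^{-1}$). Let $T_2\in\mathbb R$ be any number with $$T_2<-\tfrac12\big((b(1)-a_x(1))M(1)-a(1)M_x(1)\big),$$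 and put $$L_2=(a(1)M(1))^{-1}T_2,\qquad T_1(x)=-\big((b(1)-a_x(1))K_1(1,x)-a(1)(\partial_1K_1)(1,x)\big),$$ $$T_3(x)=-L_2a(1)K_1(1,x),\qquad L_1=\mathcal X_{\{\underline M,\underline K_1,\underline K_2\}}(T_1+T_3).$$ Then there is $\gamma>0$ such that every classical solution $e\in C^{1,2}((0,\infty),[0,1])$ of $$e_t(x,t)=a(x)e_{xx}(x,t)+b(x)e_x(x,t)+c(x)e(x,t)+L_1(x)e(1,t),\qquad e(0,t)=0,\quad e_x(1,t)=L_2e(1,t)\qquad(t>0)$$ that attains its initial value $e(0)$ in $L_2(0,1)$ as $t\to0^+$, with $e(0)\in\mathcal D_e=\{w\in H^2(0,1): w(0)=0,\ w_x(1)=L_2w(1)\}$, satisfies $$\|e(t)\|\le\gamma\|e(0)\|e^{-\delta t},\qquad t>0,$$ where $\|\cdot\|$ is the norm of $L_2(0,1)$. -/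

import Mathlib

open Set Filter Topology MeasureTheory Polynomial Matrix

noncomputable section

namespace ObserverSynthesis

/-- Value `K(x, ξ)` of a bivariate polynomial. -/
def ev₂ (K : MvPolynomial (Fin 2) ℝ) (x ξ : ℝ) : ℝ := MvPolynomial.eval ![x, ξ] K

/-- The operator `𝒳_{M,K₁,K₂}` on functions on `[0,1]`. -/
def opX (M : ℝ → ℝ) (K₁ K₂ : ℝ → ℝ → ℝ) (w : ℝ → ℝ) (x : ℝ) : ℝ :=
  M x * w x + (∫ ξ in (0 : ℝ)..x, K₁ x ξ * w ξ) + ∫ ξ in x..(1 : ℝ), K₂ x ξ * w ξ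

/-! ### The cone `Ξ` -/

/-- Vector of the monomials `1, x, …, x ^ d`. -/
def Zmon (d : ℕ) (x : ℝ) : Fin (d + 1) → ℝ := fun i => x ^ (i : ℕ)

/-- Exponents of the monomials in two variables of total degree at most `d`. -/
abbrev Idx₂ (d : ℕ) : Type :=
  {p : Fin (d + 1) × Fin (d + 1) // (p.1 : ℕ) + (p.2 : ℕ) ≤ d}

/-- Vector of the monomials `x ^ i * ξ ^ j`, `i + j ≤ d`. -/
def Zmon₂ (d : ℕ) (x ξ : ℝ) : Idx₂ d → ℝ :=
  fun p => x ^ (p.1.1 : ℕ) * ξ ^ (p.1.2 : ℕ)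

/-- `{M, K₁, K₂} ∈ Ξ_{d₁,d₂,ε}`. -/
def InXi (d₁ d₂ : ℕ) (ε : ℝ) (M : ℝ → ℝ) (K₁ K₂ : ℝ → ℝ → ℝ) : Prop :=
  ∃ (P₁₁ : Matrix (Fin (d₁ + 1)) (Fin (d₁ + 1)) ℝ)
    (P₁₂ P₁₃ : Matrix (Fin (d₁ + 1)) (Idx₂ d₂) ℝ)
    (P₂₂ P₂₃ P₃₃ : Matrix (Idx₂ d₂) (Idx₂ d₂) ℝ),
    (Matrix.fromBlocks (P₁₁ - Matrix.single 0 0 ε) (Matrix.fromCols P₁₂ P₁₃)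
      (Matrix.fromRows P₁₂ᵀ P₁₃ᵀ) (Matrix.fromBlocks P₂₂ P₂₃ P₂₃ᵀ P₃₃)).PosSemidef ∧
    (∀ x, M x = Zmon d₁ x ⬝ᵥ (P₁₁ *ᵥ Zmon d₁ x)) ∧
    (∀ x ξ, K₁ x ξ =
      Zmon d₁ x ⬝ᵥ (P₁₂ *ᵥ Zmon₂ d₂ x ξ)
        + Zmon₂ d₂ ξ x ⬝ᵥ (P₁₃ᵀ *ᵥ Zmon d₁ ξ)
        + (∫ η in (0 : ℝ)..ξ, Zmon₂ d₂ η x ⬝ᵥ (P₃₃ *ᵥ Zmon₂ d₂ η ξ))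
        + (∫ η in ξ..x, Zmon₂ d₂ η x ⬝ᵥ (P₂₃ᵀ *ᵥ Zmon₂ d₂ η ξ))
        + (∫ η in x..(1 : ℝ), Zmon₂ d₂ η x ⬝ᵥ (P₂₂ *ᵥ Zmon₂ d₂ η ξ))) ∧
    (∀ x ξ, K₂ x ξ = K₁ ξ x)

/-! ### The map `Ω_s` -/

/-- First component `M̂` of `Ω_s(M, K₁, K₂)`. -/
def OmegaM (a b c : ℝ → ℝ) (α ε : ℝ) (M : ℝ → ℝ) (K₁ K₂ : ℝ → ℝ → ℝ) (x : ℝ) : ℝ :=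
  deriv (fun y => deriv (fun z => a z * M z) y - b y * M y) x
    + 2 * deriv (fun y => a y * (K₁ y x - K₂ y x)) x
    + 2 * M x * c x - Real.pi ^ 2 / 2 * α * ε

/-- Second component `K̂₁` of `Ω_s(M, K₁, K₂)`. -/
def OmegaK₁ (a b c : ℝ → ℝ) (K₁ : ℝ → ℝ → ℝ) (x ξ : ℝ) : ℝ :=
  deriv (fun y => deriv (fun z => a z * K₁ z ξ) y - b y * K₁ y ξ) x
    + deriv (fun y => deriv (fun z => a z * K₁ x z) y - b y * K₁ x y) ξ
    + (c x + c ξ) * K₁ x ξ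

/-- Third component `K̂₂` of `Ω_s(M, K₁, K₂)`. -/
def OmegaK₂ (a b c : ℝ → ℝ) (K₁ : ℝ → ℝ → ℝ) (x ξ : ℝ) : ℝ :=
  OmegaK₁ a b c K₁ ξ x

/-! ### The inverse of `𝒳_{M,K₁,K₂}` for `K₁(x,ξ) = F(x)ᵀ G(ξ)`, `K₂(x,ξ) = G(x)ᵀ F(ξ)` -/

section Inverse

variable {r : ℕ}

/-- The column `B(x) = [G(x); F(x)]`. -/
def invB (F G : Fin r → ℝ[X]) (x : ℝ) : Fin r ⊕ Fin r → ℝ :=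
  Sum.elim (fun i => (G i).eval x) (fun i => (F i).eval x)

/-- The row `C(x) = [F(x)ᵀ, -G(x)ᵀ]`. -/
def invC (F G : Fin r → ℝ[X]) (x : ℝ) : Fin r ⊕ Fin r → ℝ :=
  Sum.elim (fun i => (F i).eval x) (fun i => -(G i).eval x)

/-- The iterates `U₁ = I`, `Uₙ₊₁(x) = I - ∫₀ˣ B(ξ) M(ξ)⁻¹ C(ξ) Uₙ(ξ) dξ`
(indexed from `0` here). -/
def invUIter (M : ℝ → ℝ) (F G : Fin r → ℝ[X]) :
    ℕ → ℝ → Matrix (Fin r ⊕ Fin r) (Fin r ⊕ Fin r) ℝ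
  | 0 => fun _ => 1
  | n + 1 => fun x => 1 - Matrix.of fun i j => ∫ ξ in (0 : ℝ)..x,
      (((M ξ)⁻¹ • Matrix.vecMulVec (invB F G ξ) (invC F G ξ)) * invUIter M F G n ξ) i j

/-- `U(x) = lim Uₙ(x)`. -/
def invU (M : ℝ → ℝ) (F G : Fin r → ℝ[X]) (x : ℝ) :
    Matrix (Fin r ⊕ Fin r) (Fin r ⊕ Fin r) ℝ :=
  limUnder atTop fun n => invUIter M F G n x

/-- `H = (N₁ + N₂ U(1))⁻¹ N₂ U(1)` with `N₁ = diag(I, 0)`, `N₂ = diag(0, I)`. -/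
def invH (M : ℝ → ℝ) (F G : Fin r → ℝ[X]) :
    Matrix (Fin r ⊕ Fin r) (Fin r ⊕ Fin r) ℝ :=
  (Matrix.fromBlocks 1 0 0 0 + Matrix.fromBlocks 0 0 0 1 * invU M F G 1)⁻¹
    * (Matrix.fromBlocks 0 0 0 1 * invU M F G 1)

/-- The multiplier of the inverse operator. -/
def invM (M : ℝ → ℝ) (x : ℝ) : ℝ := (M x)⁻¹

/-- The lower kernel of the inverse operator. -/
def invK₁ (M : ℝ → ℝ) (F G : Fin r → ℝ[X]) (x ξ : ℝ) : ℝ :=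
  (M x)⁻¹ * (invC F G x ⬝ᵥ
    ((invU M F G x * (invH M F G - 1) * (invU M F G ξ)⁻¹) *ᵥ invB F G ξ)) * (M ξ)⁻¹

/-- The upper kernel of the inverse operator. -/
def invK₂ (M : ℝ → ℝ) (F G : Fin r → ℝ[X]) (x ξ : ℝ) : ℝ :=
  (M x)⁻¹ * (invC F G x ⬝ᵥ
    ((invU M F G x * invH M F G * (invU M F G ξ)⁻¹) *ᵥ invB F G ξ)) * (M ξ)⁻¹

end Inverse

/-! ### The error dynamics -/

/-- The norm of `L₂(0,1)`. -/
def l2norm (w : ℝ → ℝ) : ℝ := Real.sqrt (∫ x in (0 : ℝ)..1, w x ^ 2)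

/-- `g` is a weak derivative of `f` on `(0,1)`. -/
def IsWeakDeriv (f g : ℝ → ℝ) : Prop :=
  ∀ φ : ℝ → ℝ, ContDiff ℝ (⊤ : ℕ∞) φ → HasCompactSupport φ → tsupport φ ⊆ Ioo 0 1 →
    ∫ x in (0 : ℝ)..1, f x * deriv φ x = -∫ x in (0 : ℝ)..1, g x * φ x

/-- `𝒟_e = {w ∈ H²(0,1) : w(0) = 0, w_x(1) = L₂ w(1)}`. The boundary values are those of the
continuous representatives of `w` and of its weak derivative. -/
def InDe (L₂ : ℝ) (w : ℝ → ℝ) : Prop :=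
  ∃ w' w'' : ℝ → ℝ, ContinuousOn w (Icc 0 1) ∧ ContinuousOn w' (Icc 0 1) ∧
    MemLp w'' 2 (volume.restrict (Ioo 0 1)) ∧ IsWeakDeriv w w' ∧ IsWeakDeriv w' w'' ∧
    w 0 = 0 ∧ w' 1 = L₂ * w 1

/-- `e` (as `e t x`) is a classical solution, of class `C^{1,2}((0,∞),[0,1])`, of
`e_t = a e_xx + b e_x + c e + L₁(x) e(1,t)`, `e(0,t) = 0`, `e_x(1,t) = L₂ e(1,t)`,
which attains its initial value `e 0` in `L₂(0,1)`. -/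
def IsErrorSolution (a b c L₁ : ℝ → ℝ) (L₂ : ℝ) (e : ℝ → ℝ → ℝ) : Prop :=
  (∃ et ex exx : ℝ → ℝ → ℝ,
    ContinuousOn (Function.uncurry e) (Ioi 0 ×ˢ Icc 0 1) ∧
    ContinuousOn (Function.uncurry et) (Ioi 0 ×ˢ Icc 0 1) ∧
    ContinuousOn (Function.uncurry ex) (Ioi 0 ×ˢ Icc 0 1) ∧
    ContinuousOn (Function.uncurry exx) (Ioi 0 ×ˢ Icc 0 1) ∧
    (∀ t > 0, ∀ x ∈ Icc (0 : ℝ) 1,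
      HasDerivAt (fun s => e s x) (et t x) t ∧
      HasDerivWithinAt (e t) (ex t x) (Icc 0 1) x ∧
      HasDerivWithinAt (ex t) (exx t x) (Icc 0 1) x ∧
      et t x = a x * exx t x + b x * ex t x + c x * e t x + L₁ x * e t 1) ∧
    (∀ t > 0, e t 0 = 0 ∧ ex t 1 = L₂ * e t 1)) ∧
  Tendsto (fun t => l2norm (fun x => e t x - e 0 x)) (𝓝[>] 0) (𝓝 0)

end ObserverSynthesis

end

open ObserverSynthesis

namespace ObserverSynthesis

/-! ### Integrals over the triangle `0 ≤ ξ ≤ x ≤ 1` -/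

/-! The proof is a Lyapunov argument with V(t) = ⟨e(t), 𝒳 e(t)⟩, where 𝒳 is the operator of (M, K₁,
K₂) and V is `quadForm`.

V is comparable with ‖e‖². The lower bound ε‖w‖² ≤ ⟨w, 𝒳w⟩ is `InXi.le_quadForm`: integrate the
nonnegative quadratic form of the block matrix at the vector (w Z₁, ∫₀ˣ Z₂ w, ∫ₓ¹ Z₂ w) and reorder
the integrals. The upper bound is `exists_quadForm_le`.

V decays. By symmetry of 𝒳, V' = 2⟨𝒳e, e_t⟩. Integration by parts moves the differential operator
onto M and the kernel (`integral_multiplier_part`, `integral_kernel_part`). At 0 the boundary terms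
vanish because e(0,t) = 0 and K₂(0,·) = 0. At 1 there remain a multiple of e(1)², nonpositive by the
choice of T₂, and e(1) times a linear functional of e. That functional is -⟨T₁ + T₃, e⟩, and it
cancels the injection term because 𝒳L₁ = T₁ + T₃ and 𝒳 is symmetric. The term -2∫aM e_x² is at most
-(π²/2)αε‖e‖² by Wirtinger's inequality. What is left is the form of Ω_s (`dissipation_inequality`),
which the second cone condition bounds by -2δV. Hence V(t)exp(2δt) is nonincreasing
(`lyapunov_antitone`), and `decay_of_lyapunov` concludes.

The identity 𝒳L₁ = T₁ + T₃ is `opX_inverse`. Since the kernel is separable, 𝒳ℓ = g is a linear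
two-point boundary value problem for z = (-∫₀ˣ Gℓ, ∫ₓ¹ Fℓ). U is its fundamental matrix and H
encodes the boundary conditions; coercivity of 𝒳 makes the problem uniquely solvable. -/

theorem hasDerivAt_integral_left {f : ℝ → ℝ} (hf : Continuous f) (x : ℝ) :
    HasDerivAt (fun x => ∫ ξ in (0 : ℝ)..x, f ξ) (f x) x :=
  (hf.integral_hasStrictDerivAt 0 x).hasDerivAt

theorem hasDerivAt_integral_right {f : ℝ → ℝ} (hf : Continuous f) (x : ℝ) :
    HasDerivAt (fun x => ∫ ξ in x..(1 : ℝ), f ξ) (-f x) x := by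
  have h := (hf.integral_hasStrictDerivAt 1 x).hasDerivAt.neg
  refine h.congr_of_eventuallyEq (Eventually.of_forall fun y => ?_)
  simp only [Pi.neg_apply]
  exact intervalIntegral.integral_symm _ _

theorem continuous_integral_left {f : ℝ → ℝ} (hf : Continuous f) :
    Continuous fun x => ∫ ξ in (0 : ℝ)..x, f ξ :=
  continuous_iff_continuousAt.2 fun x => (hasDerivAt_integral_left hf x).continuousAt

theorem continuous_integral_right {f : ℝ → ℝ} (hf : Continuous f) :
    Continuous fun x => ∫ ξ in x..(1 : ℝ), f ξ :=
  continuous_iff_continuousAt.2 fun x => (hasDerivAt_integral_right hf x).continuousAt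

/-- This replaces Fubini on the triangle: products of primitives taken from 0 and from 1 vanish at
both ends, and expanding their derivative yields each exchange of integration order below. -/
theorem integral_deriv_eq_zero {Φ φ : ℝ → ℝ} (h : ∀ x, HasDerivAt Φ (φ x) x) (hφ : Continuous φ)
    (h0 : Φ 0 = 0) (h1 : Φ 1 = 0) : ∫ x in (0 : ℝ)..1, φ x = 0 := by
  rw [intervalIntegral.integral_eq_sub_of_hasDerivAt (fun x _ => h x)
    (hφ.intervalIntegrable _ _), h0, h1, sub_zero]

theorem integral_triangle_swap {f g : ℝ → ℝ} (hf : Continuous f) (hg : Continuous g) :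
    ∫ x in (0 : ℝ)..1, f x * ∫ ξ in (0 : ℝ)..x, g ξ
      = ∫ x in (0 : ℝ)..1, g x * ∫ ξ in x..(1 : ℝ), f ξ := by
  have hcg := continuous_integral_left hg
  have hcf := continuous_integral_right hf
  have h := integral_deriv_eq_zero
    (fun x => (hasDerivAt_integral_left hg x).mul (hasDerivAt_integral_right hf x))
    (by fun_prop) (by simp) (by simp)
  rw [intervalIntegral.integral_add (Continuous.intervalIntegrable (by fun_prop) _ _)
    (Continuous.intervalIntegrable (by fun_prop) _ _)] at h
  have h2 : ∫ x in (0 : ℝ)..1, f x * ∫ ξ in (0 : ℝ)..x, g ξ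
      = -∫ x in (0 : ℝ)..1, (∫ ξ in (0 : ℝ)..x, g ξ) * -f x := by
    rw [← intervalIntegral.integral_neg]
    exact intervalIntegral.integral_congr fun x _ => by ring
  rw [h2]
  linarith

/-- `∫ w(x) ∫₀ˣ K(x, ξ) w(ξ) dξ dx` over `0 ≤ x ≤ 1`. -/
noncomputable def triForm (K : ℝ → ℝ → ℝ) (w : ℝ → ℝ) : ℝ :=
  ∫ x in (0 : ℝ)..1, w x * ∫ ξ in (0 : ℝ)..x, K x ξ * w ξ

/-- The quadratic form `⟨w, 𝒳 w⟩` of the operator with multiplier `M` and symmetric kernel equal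
to `K` below the diagonal. -/
noncomputable def quadForm (M : ℝ → ℝ) (K : ℝ → ℝ → ℝ) (w : ℝ → ℝ) : ℝ :=
  (∫ x in (0 : ℝ)..1, M x * w x ^ 2) + 2 * triForm K w

theorem continuous_inner {K : ℝ → ℝ → ℝ} {w : ℝ → ℝ} (hK : Continuous (Function.uncurry K))
    (hw : Continuous w) : Continuous fun x => ∫ ξ in (0 : ℝ)..x, K x ξ * w ξ := by
  apply intervalIntegral.continuous_parametric_intervalIntegral_of_continuous _ continuous_id
  have : Function.uncurry (fun x ξ => K x ξ * w ξ)
      = fun p : ℝ × ℝ => Function.uncurry K p * w p.2 := by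
    ext ⟨x, y⟩; rfl
  rw [this]
  fun_prop

theorem triForm_sum {ι : Type*} (s : Finset ι) {K : ι → ℝ → ℝ → ℝ} {w : ℝ → ℝ} (c : ι → ℝ)
    (hK : ∀ i, Continuous (Function.uncurry (K i))) (hw : Continuous w) :
    triForm (fun x ξ => ∑ i ∈ s, c i * K i x ξ) w = ∑ i ∈ s, c i * triForm (K i) w := by
  unfold triForm
  have h1 : ∀ x, ∫ ξ in (0 : ℝ)..x, (∑ i ∈ s, c i * K i x ξ) * w ξ
      = ∑ i ∈ s, c i * ∫ ξ in (0 : ℝ)..x, K i x ξ * w ξ := by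
    intro x
    simp_rw [Finset.sum_mul, mul_assoc]
    rw [intervalIntegral.integral_finsetSum]
    · simp_rw [intervalIntegral.integral_const_mul]
    · intro i _
      have : Continuous fun ξ => K i x ξ := (hK i).uncurry_left x
      exact (by fun_prop : Continuous fun ξ => c i * (K i x ξ * w ξ)).intervalIntegrable _ _
  simp_rw [h1, Finset.mul_sum]
  rw [intervalIntegral.integral_finsetSum]
  · refine Finset.sum_congr rfl fun i _ => ?_
    rw [← intervalIntegral.integral_const_mul]
    exact intervalIntegral.integral_congr fun x _ => by ring
  · intro i _
    have := continuous_inner (hK i) hw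
    exact (by fun_prop : Continuous fun x => w x * (c i * ∫ ξ in (0 : ℝ)..x, K i x ξ * w ξ)).intervalIntegrable _ _

theorem triForm_add {K L : ℝ → ℝ → ℝ} {w : ℝ → ℝ}
    (hK : Continuous (Function.uncurry K)) (hL : Continuous (Function.uncurry L))
    (hw : Continuous w) :
    triForm (fun x ξ => K x ξ + L x ξ) w = triForm K w + triForm L w := by
  have h := triForm_sum Finset.univ (K := ![K, L]) (w := w) (fun _ => 1)
    (by intro i; fin_cases i <;> assumption) hw
  simpa using h

theorem triForm_smul {K : ℝ → ℝ → ℝ} {w : ℝ → ℝ} (c : ℝ)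
    (hK : Continuous (Function.uncurry K)) (hw : Continuous w) :
    triForm (fun x ξ => c * K x ξ) w = c * triForm K w := by
  have h := triForm_sum {()} (K := fun _ => K) (w := w) (fun _ => c) (fun _ => hK) hw
  simpa using h

theorem triForm_sum₂ {ι κ : Type*} [Fintype ι] [Fintype κ] {K : ι → κ → ℝ → ℝ → ℝ} {w : ℝ → ℝ}
    (c : Matrix ι κ ℝ) (hK : ∀ i j, Continuous (Function.uncurry (K i j))) (hw : Continuous w) :
    triForm (fun x ξ => ∑ i, ∑ j, c i j * K i j x ξ) w
      = ∑ i, ∑ j, c i j * triForm (K i j) w := by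
  have h := triForm_sum (Finset.univ : Finset (ι × κ)) (K := fun p => K p.1 p.2) (w := w)
    (fun p => c p.1 p.2) (fun p => hK p.1 p.2) hw
  simpa [Fintype.sum_prod_type] using h

theorem integral_sum₂ {ι κ : Type*} [Fintype ι] [Fintype κ] {f : ι → κ → ℝ → ℝ}
    (c : Matrix ι κ ℝ) (hf : ∀ i j, Continuous (f i j)) (a b : ℝ) :
    ∫ x in a..b, ∑ i, ∑ j, c i j * f i j x = ∑ i, ∑ j, c i j * ∫ x in a..b, f i j x := by
  rw [intervalIntegral.integral_finsetSum]
  · refine Finset.sum_congr rfl fun i _ => ?_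
    rw [intervalIntegral.integral_finsetSum]
    · simp_rw [intervalIntegral.integral_const_mul]
    · exact fun j _ => ((hf i j).const_mul _).intervalIntegrable _ _
  · intro i _
    exact (continuous_finsetSum _ fun j _ => (hf i j).const_mul _).intervalIntegrable _ _

theorem triForm_separable {K : ℝ → ℝ → ℝ} {u v w : ℝ → ℝ} (hK : ∀ x ξ, K x ξ = u x * v ξ) :
    triForm K w = ∫ x in (0 : ℝ)..1, (u x * w x) * ∫ ξ in (0 : ℝ)..x, v ξ * w ξ := by
  refine intervalIntegral.integral_congr fun x _ => ?_
  simp only [hK, mul_assoc, intervalIntegral.integral_const_mul]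
  ring

/-! ### Triple products of primitives as iterated integrals below the diagonal -/

section Products

variable {s p q : ℝ → ℝ}

/-- The product (∫ₓ¹ s)(∫₀ˣ p)(∫₀ˣ q) vanishes at 0 and 1. The three identities of this section
produce the η-integrals over [x,1], [0,ξ] and [ξ,x] in the kernel of the cone `Ξ`, paired with
`P₂₂`, `P₃₃` and `P₂₃` respectively. -/
theorem integral_mul_lower_lower (hs : Continuous s) (hp : Continuous p) (hq : Continuous q) :
    ∫ x in (0 : ℝ)..1, s x * ((∫ ξ in (0 : ℝ)..x, p ξ) * ∫ ξ in (0 : ℝ)..x, q ξ)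
      = (∫ x in (0 : ℝ)..1, ((∫ ξ in x..(1 : ℝ), s ξ) * p x) * ∫ ξ in (0 : ℝ)..x, q ξ)
        + ∫ x in (0 : ℝ)..1, ((∫ ξ in x..(1 : ℝ), s ξ) * q x) * ∫ ξ in (0 : ℝ)..x, p ξ := by
  have cp := continuous_integral_left hp
  have cq := continuous_integral_left hq
  have cs := continuous_integral_right hs
  have h := integral_deriv_eq_zero (fun x => (hasDerivAt_integral_right hs x).mul
    ((hasDerivAt_integral_left hp x).mul (hasDerivAt_integral_left hq x)))
    (by simp only [Pi.mul_apply]; fun_prop) (by simp) (by simp)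
  simp only [Pi.mul_apply] at h
  rw [← intervalIntegral.integral_add (Continuous.intervalIntegrable (by fun_prop) _ _)
    (Continuous.intervalIntegrable (by fun_prop) _ _), ← sub_eq_zero,
    ← intervalIntegral.integral_sub (Continuous.intervalIntegrable (by fun_prop) _ _)
    (Continuous.intervalIntegrable (by fun_prop) _ _), ← neg_eq_zero,
    ← intervalIntegral.integral_neg]
  refine Eq.trans ?_ h
  exact intervalIntegral.integral_congr fun x _ => by ring

theorem integral_mul_upper_upper (hs : Continuous s) (hp : Continuous p) (hq : Continuous q) :
    ∫ x in (0 : ℝ)..1, s x * ((∫ ξ in x..(1 : ℝ), p ξ) * ∫ ξ in x..(1 : ℝ), q ξ)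
      = (∫ x in (0 : ℝ)..1, p x * ∫ ξ in (0 : ℝ)..x, (∫ η in (0 : ℝ)..ξ, s η) * q ξ)
        + ∫ x in (0 : ℝ)..1, q x * ∫ ξ in (0 : ℝ)..x, (∫ η in (0 : ℝ)..ξ, s η) * p ξ := by
  have cp := continuous_integral_right hp
  have cq := continuous_integral_right hq
  have cs := continuous_integral_left hs
  rw [integral_triangle_swap hp (by fun_prop), integral_triangle_swap hq (by fun_prop)]
  have h := integral_deriv_eq_zero (fun x => (hasDerivAt_integral_left hs x).mul
    ((hasDerivAt_integral_right hp x).mul (hasDerivAt_integral_right hq x)))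
    (by simp only [Pi.mul_apply]; fun_prop) (by simp) (by simp)
  simp only [Pi.mul_apply] at h
  rw [← intervalIntegral.integral_add (Continuous.intervalIntegrable (by fun_prop) _ _)
    (Continuous.intervalIntegrable (by fun_prop) _ _), ← sub_eq_zero,
    ← intervalIntegral.integral_sub (Continuous.intervalIntegrable (by fun_prop) _ _)
    (Continuous.intervalIntegrable (by fun_prop) _ _)]
  refine Eq.trans ?_ h
  exact intervalIntegral.integral_congr fun x _ => by ring

/-- Splitting ∫_ξ^x s = ∫₀ˣ s - ∫₀^ξ s separates the variables; then (∫₀ˣ s)(∫₀ˣ p)(∫ₓ¹ q) vanishes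
at both ends. -/
theorem integral_mul_lower_upper (hs : Continuous s) (hp : Continuous p) (hq : Continuous q) :
    ∫ x in (0 : ℝ)..1, s x * ((∫ ξ in (0 : ℝ)..x, p ξ) * ∫ ξ in x..(1 : ℝ), q ξ)
      = ∫ x in (0 : ℝ)..1, q x * ∫ ξ in (0 : ℝ)..x, (∫ η in ξ..x, s η) * p ξ := by
  have cp := continuous_integral_left hp
  have cq := continuous_integral_right hq
  have cs := continuous_integral_left hs
  have h1 : ∀ x, ∫ ξ in (0 : ℝ)..x, (∫ η in ξ..x, s η) * p ξ
      = (∫ η in (0 : ℝ)..x, s η) * (∫ ξ in (0 : ℝ)..x, p ξ)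
        - ∫ ξ in (0 : ℝ)..x, (∫ η in (0 : ℝ)..ξ, s η) * p ξ := by
    intro x
    rw [← intervalIntegral.integral_const_mul, ← intervalIntegral.integral_sub
      (Continuous.intervalIntegrable (by fun_prop) _ _)
      (Continuous.intervalIntegrable (by fun_prop) _ _)]
    refine intervalIntegral.integral_congr fun ξ _ => ?_
    rw [← sub_mul, intervalIntegral.integral_interval_sub_left (hs.intervalIntegrable _ _)
      (hs.intervalIntegrable _ _)]
  have csp := continuous_integral_left (cs.mul hp)
  simp_rw [h1, mul_sub]
  rw [intervalIntegral.integral_sub (Continuous.intervalIntegrable (by fun_prop) _ _)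
      (Continuous.intervalIntegrable (by fun_prop) _ _), integral_triangle_swap hq (by fun_prop)]
  have h := integral_deriv_eq_zero (fun x => (hasDerivAt_integral_left hs x).mul
    ((hasDerivAt_integral_left hp x).mul (hasDerivAt_integral_right hq x)))
    (by simp only [Pi.mul_apply]; fun_prop) (by simp) (by simp)
  simp only [Pi.mul_apply] at h
  rw [← intervalIntegral.integral_sub (Continuous.intervalIntegrable (by fun_prop) _ _)
    (Continuous.intervalIntegrable (by fun_prop) _ _), ← sub_eq_zero,
    ← intervalIntegral.integral_sub (Continuous.intervalIntegrable (by fun_prop) _ _)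
    (Continuous.intervalIntegrable (by fun_prop) _ _)]
  refine Eq.trans ?_ h
  exact intervalIntegral.integral_congr fun x _ => by ring

end Products

/-! ### Positivity of the operators of the cone `Ξ` -/

theorem dotProduct_mulVec_eq_sum {ι κ : Type*} [Fintype ι] [Fintype κ] (A : Matrix ι κ ℝ)
    (u : ι → ℝ) (v : κ → ℝ) : u ⬝ᵥ (A *ᵥ v) = ∑ i, ∑ j, A i j * (u i * v j) := by
  simp only [dotProduct, Matrix.mulVec, Finset.mul_sum]
  exact Finset.sum_congr rfl fun i _ => Finset.sum_congr rfl fun j _ => by ring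

theorem dotProduct_transpose_mulVec_eq_sum {ι κ : Type*} [Fintype ι] [Fintype κ]
    (A : Matrix κ ι ℝ) (u : ι → ℝ) (v : κ → ℝ) :
    u ⬝ᵥ (Aᵀ *ᵥ v) = ∑ j, ∑ i, A j i * (v j * u i) := by
  rw [dotProduct_mulVec_eq_sum, Finset.sum_comm]
  exact Finset.sum_congr rfl fun i _ => Finset.sum_congr rfl fun j _ => by
    rw [Matrix.transpose_apply, mul_comm (u j)]

theorem blocks_quadratic {ι κ : Type*} [Fintype ι] [Fintype κ] (A : Matrix ι ι ℝ)
    (B C : Matrix ι κ ℝ) (D E F : Matrix κ κ ℝ) (z : ι → ℝ) (u v : κ → ℝ) :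
    Sum.elim z (Sum.elim u v) ⬝ᵥ (Matrix.fromBlocks A (Matrix.fromCols B C)
      (Matrix.fromRows Bᵀ Cᵀ) (Matrix.fromBlocks D E Eᵀ F)) *ᵥ Sum.elim z (Sum.elim u v)
      = (∑ i, ∑ j, A i j * (z i * z j)) + 2 * (∑ i, ∑ p, B i p * (z i * u p))
        + 2 * (∑ i, ∑ p, C i p * (z i * v p)) + (∑ p, ∑ q, D p q * (u p * u q))
        + 2 * (∑ p, ∑ q, E p q * (u p * v q)) + ∑ p, ∑ q, F p q * (v p * v q) := by
  simp only [dotProduct, Matrix.mulVec, Fintype.sum_sum_type, Sum.elim_inl, Sum.elim_inr,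
    Matrix.fromBlocks_apply₁₁, Matrix.fromBlocks_apply₁₂, Matrix.fromBlocks_apply₂₁,
    Matrix.fromBlocks_apply₂₂, Matrix.fromCols_apply_inl, Matrix.fromCols_apply_inr,
    Matrix.fromRows_apply_inl, Matrix.fromRows_apply_inr, Matrix.transpose_apply, mul_add,
    Finset.sum_add_distrib]
  have hB := dotProduct_transpose_mulVec_eq_sum B u z
  have hC := dotProduct_transpose_mulVec_eq_sum C v z
  have hE := dotProduct_transpose_mulVec_eq_sum E v u
  have hA := dotProduct_mulVec_eq_sum A z z
  have hB' := dotProduct_mulVec_eq_sum B z u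
  have hC' := dotProduct_mulVec_eq_sum C z v
  have hD := dotProduct_mulVec_eq_sum D u u
  have hE' := dotProduct_mulVec_eq_sum E u v
  have hF := dotProduct_mulVec_eq_sum F v v
  simp only [dotProduct, Matrix.mulVec, Matrix.transpose_apply] at hA hB hB' hC hC' hD hE hE' hF
  rw [hA, hB, hB', hC, hC', hD, hE, hE', hF]
  ring

/-- The diagonal blocks `P₂₂` and `P₃₃` produce symmetrized sums of kernel forms. Symmetry of the
block folds them into the factor 2 that `quadForm` puts before `triForm`. -/
theorem sum_symm_eq_two_mul {κ : Type*} [Fintype κ] {P : Matrix κ κ ℝ} (hP : Pᵀ = P)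
    (f : κ → κ → ℝ) : ∑ p, ∑ q, P p q * (f p q + f q p) = 2 * ∑ p, ∑ q, P p q * f p q := by
  have h : ∑ p, ∑ q, P p q * f q p = ∑ p, ∑ q, P p q * f p q := by
    rw [Finset.sum_comm]
    refine Finset.sum_congr rfl fun p _ => Finset.sum_congr rfl fun q _ => ?_
    rw [← Matrix.transpose_apply P p q, hP]
  simp only [mul_add, Finset.sum_add_distrib, h]
  ring

/-- Test the block matrix at (Z₁(x), 0, 0); the subtracted `ε` meets only the constant monomial 1.
-/
theorem InXi.le_multiplier {d₁ d₂ : ℕ} {ε : ℝ} {M : ℝ → ℝ} {K₁ K₂ : ℝ → ℝ → ℝ}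
    (h : InXi d₁ d₂ ε M K₁ K₂) (x : ℝ) : ε ≤ M x := by
  obtain ⟨P₁₁, P₁₂, P₁₃, P₂₂, P₂₃, P₃₃, hP, hM, -, -⟩ := h
  have := hP.dotProduct_mulVec_nonneg (Sum.elim (Zmon d₁ x) (Sum.elim 0 0))
  rw [star_trivial, blocks_quadratic] at this
  simp only [Pi.zero_apply, mul_zero, Finset.sum_const_zero, add_zero,
    ← dotProduct_mulVec_eq_sum, Matrix.sub_mulVec, dotProduct_sub, ← hM] at this
  have h0 : Zmon d₁ x ⬝ᵥ Matrix.single 0 0 ε *ᵥ Zmon d₁ x = ε := by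
    simp [Matrix.single_mulVec, Zmon, dotProduct, Function.update_apply]
  linarith

section Cone

variable {d : ℕ} {w : ℝ → ℝ}

theorem continuous_integral_endpoints {s : ℝ → ℝ} (hs : Continuous s) :
    Continuous fun p : ℝ × ℝ => ∫ η in p.1..p.2, s η := by
  have h := continuous_integral_left hs
  have : (fun p : ℝ × ℝ => ∫ η in p.1..p.2, s η)
      = fun p => (∫ η in (0 : ℝ)..p.2, s η) - ∫ η in (0 : ℝ)..p.1, s η := by
    ext p
    rw [intervalIntegral.integral_interval_sub_left (hs.intervalIntegrable _ _)
      (hs.intervalIntegrable _ _)]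
  rw [this]
  exact (h.comp continuous_snd).sub (h.comp continuous_fst)

/-- `Z₂(η, x)ᵀ P Z₂(η, ξ)` integrated over `η`. -/
theorem integral_Zmon₂_quadratic (P : Matrix (Idx₂ d) (Idx₂ d) ℝ) (α β x ξ : ℝ) :
    ∫ η in α..β, Zmon₂ d η x ⬝ᵥ (P *ᵥ Zmon₂ d η ξ)
      = ∑ p, ∑ q, P p q * (x ^ (p.1.2 : ℕ) * ξ ^ (q.1.2 : ℕ)
          * ∫ η in α..β, η ^ (p.1.1 : ℕ) * η ^ (q.1.1 : ℕ)) := by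
  simp_rw [dotProduct_mulVec_eq_sum]
  rw [integral_sum₂ _ (fun p q => by unfold Zmon₂; fun_prop)]
  refine Finset.sum_congr rfl fun p _ => Finset.sum_congr rfl fun q _ => ?_
  congr 1
  rw [← intervalIntegral.integral_const_mul]
  exact intervalIntegral.integral_congr fun η _ => by simp only [Zmon₂]; ring

theorem triForm_congr {K L : ℝ → ℝ → ℝ} (h : ∀ x ξ, K x ξ = L x ξ) : triForm K w = triForm L w := by
  have : K = L := funext fun x => funext fun ξ => h x ξ
  rw [this]

end Cone

set_option maxHeartbeats 1000000 in
/-- The quadratic form of an operator of the cone `Ξ_ε` is bounded below by `ε ‖w‖²`. -/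
theorem InXi.le_quadForm {d₁ d₂ : ℕ} {ε : ℝ} {M : ℝ → ℝ} {K₁ K₂ : ℝ → ℝ → ℝ}
    (h : InXi d₁ d₂ ε M K₁ K₂) {w : ℝ → ℝ} (hw : Continuous w) :
    ε * ∫ x in (0 : ℝ)..1, w x ^ 2 ≤ quadForm M K₁ w := by
  obtain ⟨P₁₁, P₁₂, P₁₃, P₂₂, P₂₃, P₃₃, hP, hM, hK, -⟩ := h
  have hsym := hP.1
  have hsym' := hsym.eq
  rw [Matrix.conjTranspose_eq_transpose_of_trivial, Matrix.fromBlocks_transpose,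
    Matrix.fromBlocks_inj, Matrix.fromBlocks_transpose, Matrix.fromBlocks_inj] at hsym'
  -- Only the symmetry of the two diagonal blocks is needed: the off-diagonal blocks already occur
  -- together with their transposes.
  obtain ⟨-, -, -, h22, -, -, h33⟩ := hsym'
  -- the moments of `w`
  let μ : Idx₂ d₂ → ℝ → ℝ := fun p ξ => ξ ^ (p.1.2 : ℕ) * w ξ
  let s : Idx₂ d₂ → Idx₂ d₂ → ℝ → ℝ := fun p q η => η ^ (p.1.1 : ℕ) * η ^ (q.1.1 : ℕ)
  have hμ : ∀ p, Continuous (μ p) := fun p => by simp only [μ]; fun_prop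
  have hs : ∀ p q, Continuous (s p q) := fun p q => by simp only [s]; fun_prop
  -- Multiplied by x^i, for p = (i, j), `m` and `n` become the entries of ∫₀ˣ Z₂(x,ξ) w(ξ) dξ and
  -- ∫ₓ¹ Z₂(x,ξ) w(ξ) dξ, the last two blocks of the test vector.
  let m : Idx₂ d₂ → ℝ → ℝ := fun p x => ∫ ξ in (0 : ℝ)..x, μ p ξ
  let n : Idx₂ d₂ → ℝ → ℝ := fun p x => ∫ ξ in x..(1 : ℝ), μ p ξ
  have hm : ∀ p, Continuous (m p) := fun p => continuous_integral_left (hμ p)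
  have hn : ∀ p, Continuous (n p) := fun p => continuous_integral_right (hμ p)
  -- the pieces of the kernel
  let k12 : Fin (d₁ + 1) → Idx₂ d₂ → ℝ → ℝ → ℝ := fun i p x ξ =>
    (x ^ (i : ℕ) * x ^ (p.1.1 : ℕ)) * ξ ^ (p.1.2 : ℕ)
  let k13 : Fin (d₁ + 1) → Idx₂ d₂ → ℝ → ℝ → ℝ := fun i p x ξ =>
    x ^ (p.1.2 : ℕ) * (ξ ^ (p.1.1 : ℕ) * ξ ^ (i : ℕ))
  let k33 : Idx₂ d₂ → Idx₂ d₂ → ℝ → ℝ → ℝ := fun p q x ξ =>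
    x ^ (p.1.2 : ℕ) * (ξ ^ (q.1.2 : ℕ) * ∫ η in (0 : ℝ)..ξ, s p q η)
  -- Here x carries the exponent of q and ξ that of p, because the kernel contains the transpose of
  -- `P₂₃`.
  let k23 : Idx₂ d₂ → Idx₂ d₂ → ℝ → ℝ → ℝ := fun p q x ξ =>
    x ^ (q.1.2 : ℕ) * (ξ ^ (p.1.2 : ℕ) * ∫ η in ξ..x, s p q η)
  let k22 : Idx₂ d₂ → Idx₂ d₂ → ℝ → ℝ → ℝ := fun p q x ξ =>
    (x ^ (p.1.2 : ℕ) * ∫ η in x..(1 : ℝ), s p q η) * ξ ^ (q.1.2 : ℕ)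
  have c12 : ∀ i p, Continuous (Function.uncurry (k12 i p)) := fun i p => by
    simp only [k12, Function.uncurry_def]; fun_prop
  have c13 : ∀ i p, Continuous (Function.uncurry (k13 i p)) := fun i p => by
    simp only [k13, Function.uncurry_def]; fun_prop
  have c33 : ∀ i p, Continuous (Function.uncurry (k33 i p)) := fun i p => by
    have := continuous_integral_left (hs i p)
    simp only [k33, Function.uncurry_def]; fun_prop
  have c22 : ∀ i p, Continuous (Function.uncurry (k22 i p)) := fun i p => by
    have := continuous_integral_right (hs i p)
    simp only [k22, Function.uncurry_def]; fun_prop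
  have c23 : ∀ i p, Continuous (Function.uncurry (k23 i p)) := fun i p => by
    have := (continuous_integral_endpoints (hs i p)).comp continuous_swap
    simp only [Function.comp_def, Prod.fst_swap, Prod.snd_swap] at this
    simp only [k23, Function.uncurry_def]; fun_prop
  have hKsum : ∀ x ξ, K₁ x ξ = (∑ i, ∑ p, P₁₂ i p * k12 i p x ξ)
      + (∑ i, ∑ p, P₁₃ i p * k13 i p x ξ) + (∑ p, ∑ q, P₃₃ p q * k33 p q x ξ)
      + (∑ p, ∑ q, P₂₃ p q * k23 p q x ξ) + ∑ p, ∑ q, P₂₂ p q * k22 p q x ξ := by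
    intro x ξ
    rw [hK, dotProduct_mulVec_eq_sum, dotProduct_transpose_mulVec_eq_sum,
      integral_Zmon₂_quadratic, integral_Zmon₂_quadratic, integral_Zmon₂_quadratic]
    congr 1
    · congr 1
      · congr 1
        · congr 1
          · refine Finset.sum_congr rfl fun i _ => Finset.sum_congr rfl fun p _ => ?_
            simp only [k12, Zmon, Zmon₂]; ring
          · refine Finset.sum_congr rfl fun i _ => Finset.sum_congr rfl fun p _ => ?_
            simp only [k13, Zmon, Zmon₂]; ring
        · refine Finset.sum_congr rfl fun i _ => Finset.sum_congr rfl fun p _ => ?_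
          simp only [k33, s]; ring
      · rw [Finset.sum_comm]
        refine Finset.sum_congr rfl fun i _ => Finset.sum_congr rfl fun p _ => ?_
        simp only [k23, s, Matrix.transpose_apply, mul_comm]; ring
    · refine Finset.sum_congr rfl fun i _ => Finset.sum_congr rfl fun p _ => ?_
      simp only [k22, s]; ring
  have cs : ∀ {ι κ : Type} [Fintype ι] [Fintype κ] (c : Matrix ι κ ℝ) (k : ι → κ → ℝ → ℝ → ℝ),
      (∀ i p, Continuous (Function.uncurry (k i p))) →
      Continuous (Function.uncurry fun x ξ => ∑ i, ∑ p, c i p * k i p x ξ) := by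
    intro ι κ _ _ c k hk
    simp only [Function.uncurry_def] at hk ⊢
    exact continuous_finsetSum _ fun i _ => continuous_finsetSum _ fun p _ => (hk i p).const_mul _
  have ca : ∀ {K L : ℝ → ℝ → ℝ}, Continuous (Function.uncurry K) → Continuous (Function.uncurry L) →
      Continuous (Function.uncurry fun x ξ => K x ξ + L x ξ) := fun hK hL => hK.add hL
  have htri : triForm K₁ w = (∑ i, ∑ p, P₁₂ i p * triForm (k12 i p) w)
      + (∑ i, ∑ p, P₁₃ i p * triForm (k13 i p) w) + (∑ p, ∑ q, P₃₃ p q * triForm (k33 p q) w)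
      + (∑ p, ∑ q, P₂₃ p q * triForm (k23 p q) w) + ∑ p, ∑ q, P₂₂ p q * triForm (k22 p q) w := by
    have C1 := cs P₁₂ _ c12
    have C2 := cs P₁₃ _ c13
    have C3 := cs P₃₃ _ c33
    have C4 := cs P₂₃ _ c23
    have C5 := cs P₂₂ _ c22
    rw [triForm_congr hKsum, triForm_add (ca (ca (ca C1 C2) C3) C4) C5 hw,
      triForm_add (ca (ca C1 C2) C3) C4 hw, triForm_add (ca C1 C2) C3 hw, triForm_add C1 C2 hw,
      triForm_sum₂ _ c12 hw, triForm_sum₂ _ c13 hw, triForm_sum₂ _ c33 hw, triForm_sum₂ _ c23 hw,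
      triForm_sum₂ _ c22 hw]
  -- the integrals of the terms of the square
  have e12 : ∀ (i : Fin (d₁ + 1)) p, ∫ x in (0 : ℝ)..1, (x ^ (i : ℕ) * w x) * (x ^ (p.1.1 : ℕ) * m p x)
      = triForm (k12 i p) w := by
    intro i p
    rw [triForm_separable (u := fun x => x ^ (i : ℕ) * x ^ (p.1.1 : ℕ))
      (v := fun ξ => ξ ^ (p.1.2 : ℕ)) (fun x ξ => rfl)]
    exact intervalIntegral.integral_congr fun x _ => by simp only [m, μ]; ring
  -- The factor `n` integrates above the diagonal; swapping the order of integration exchanges x and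
  -- ξ and brings it below.
  have e13 : ∀ (i : Fin (d₁ + 1)) p,
      ∫ x in (0 : ℝ)..1, (x ^ (i : ℕ) * w x) * (x ^ (p.1.1 : ℕ) * n p x)
      = triForm (k13 i p) w := by
    intro i p
    rw [triForm_separable (u := fun x => x ^ (p.1.2 : ℕ))
      (v := fun ξ => ξ ^ (p.1.1 : ℕ) * ξ ^ (i : ℕ)) (fun x ξ => rfl),
      integral_triangle_swap (by fun_prop) (by fun_prop)]
    exact intervalIntegral.integral_congr fun x _ => by simp only [n, μ]; ring
  have e22 : ∀ p q, ∫ x in (0 : ℝ)..1, (x ^ (p.1.1 : ℕ) * m p x) * (x ^ (q.1.1 : ℕ) * m q x)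
      = triForm (k22 p q) w + triForm (k22 q p) w := by
    intro p q
    have hsymm : s q p = s p q := by ext η; simp only [s]; ring
    rw [triForm_separable (u := fun x => x ^ (p.1.2 : ℕ) * ∫ η in x..(1 : ℝ), s p q η)
      (v := fun ξ => ξ ^ (q.1.2 : ℕ)) (fun x ξ => rfl),
      triForm_separable (u := fun x => x ^ (q.1.2 : ℕ) * ∫ η in x..(1 : ℝ), s q p η)
      (v := fun ξ => ξ ^ (p.1.2 : ℕ)) (fun x ξ => rfl), hsymm]
    refine Eq.trans ?_ ((integral_mul_lower_lower (hs p q) (hμ p) (hμ q)).trans ?_)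
    · exact intervalIntegral.integral_congr fun x _ => by simp only [s, m]; ring
    · congr 1 <;> exact intervalIntegral.integral_congr fun x _ => by simp only [μ]; ring
  have e33 : ∀ p q, ∫ x in (0 : ℝ)..1, (x ^ (p.1.1 : ℕ) * n p x) * (x ^ (q.1.1 : ℕ) * n q x)
      = triForm (k33 p q) w + triForm (k33 q p) w := by
    intro p q
    have hsymm : s q p = s p q := by ext η; simp only [s]; ring
    rw [triForm_separable (u := fun x => x ^ (p.1.2 : ℕ))
      (v := fun ξ => ξ ^ (q.1.2 : ℕ) * ∫ η in (0 : ℝ)..ξ, s p q η) (fun x ξ => rfl),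
      triForm_separable (u := fun x => x ^ (q.1.2 : ℕ))
      (v := fun ξ => ξ ^ (p.1.2 : ℕ) * ∫ η in (0 : ℝ)..ξ, s q p η) (fun x ξ => rfl), hsymm]
    refine Eq.trans ?_ ((integral_mul_upper_upper (hs p q) (hμ p) (hμ q)).trans ?_)
    · exact intervalIntegral.integral_congr fun x _ => by simp only [s, n]; ring
    · congr 1 <;>
      · refine intervalIntegral.integral_congr fun x _ => ?_
        simp only [μ]
        congr 1
        exact intervalIntegral.integral_congr fun ξ _ => by ring
  have e23 : ∀ p q, ∫ x in (0 : ℝ)..1, (x ^ (p.1.1 : ℕ) * m p x) * (x ^ (q.1.1 : ℕ) * n q x)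
      = triForm (k23 p q) w := by
    intro p q
    refine Eq.trans ?_ ((integral_mul_lower_upper (hs p q) (hμ p) (hμ q)).trans ?_)
    · exact intervalIntegral.integral_congr fun x _ => by simp only [s, m, n]; ring
    · refine intervalIntegral.integral_congr fun x _ => ?_
      simp only [μ, k23]
      rw [mul_comm (x ^ (q.1.2 : ℕ)) (w x), mul_assoc, ← intervalIntegral.integral_const_mul]
      congr 1
      exact intervalIntegral.integral_congr fun ξ _ => by ring
  clear_value k12 k13 k33 k23 k22 m n
  -- integrate the nonnegative square
  have hpos : ∀ x, 0 ≤ (M x * w x ^ 2 - ε * w x ^ 2)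
      + 2 * (∑ i, ∑ p, P₁₂ i p * ((x ^ (i : ℕ) * w x) * (x ^ (p.1.1 : ℕ) * m p x)))
      + 2 * (∑ i, ∑ p, P₁₃ i p * ((x ^ (i : ℕ) * w x) * (x ^ (p.1.1 : ℕ) * n p x)))
      + (∑ p, ∑ q, P₂₂ p q * ((x ^ (p.1.1 : ℕ) * m p x) * (x ^ (q.1.1 : ℕ) * m q x)))
      + 2 * (∑ p, ∑ q, P₂₃ p q * ((x ^ (p.1.1 : ℕ) * m p x) * (x ^ (q.1.1 : ℕ) * n q x)))
      + ∑ p, ∑ q, P₃₃ p q * ((x ^ (p.1.1 : ℕ) * n p x) * (x ^ (q.1.1 : ℕ) * n q x)) := by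
    intro x
    have h := hP.dotProduct_mulVec_nonneg (Sum.elim (fun i => x ^ (i : ℕ) * w x)
      (Sum.elim (fun p => x ^ (p.1.1 : ℕ) * m p x) (fun p => x ^ (p.1.1 : ℕ) * n p x)))
    rw [star_trivial, blocks_quadratic] at h
    have h1 : ∑ i : Fin (d₁ + 1), ∑ j : Fin (d₁ + 1), (P₁₁ - Matrix.single 0 0 ε : Matrix _ _ ℝ) i j * ((x ^ (i : ℕ) * w x) * (x ^ (j : ℕ) * w x))
        = M x * w x ^ 2 - ε * w x ^ 2 := by
      have h0 : Zmon d₁ x ⬝ᵥ Matrix.single 0 0 ε *ᵥ Zmon d₁ x = ε := by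
        simp [Matrix.single_mulVec, Zmon, dotProduct, Function.update_apply]
      have h2 : Zmon d₁ x ⬝ᵥ (P₁₁ - Matrix.single 0 0 ε) *ᵥ Zmon d₁ x = M x - ε := by
        rw [Matrix.sub_mulVec, dotProduct_sub, h0, hM]
      rw [← sub_mul, ← h2, dotProduct_mulVec_eq_sum]
      simp only [Finset.sum_mul]
      exact Finset.sum_congr rfl fun i _ => Finset.sum_congr rfl fun j _ => by
        simp only [Zmon]; ring
    rw [h1] at h
    exact h
  have hMc : Continuous M := by
    rw [funext hM]
    simp_rw [dotProduct_mulVec_eq_sum]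
    unfold Zmon
    fun_prop
  have hint := intervalIntegral.integral_nonneg (μ := volume) zero_le_one fun x _ => hpos x
  rw [intervalIntegral.integral_add, intervalIntegral.integral_add, intervalIntegral.integral_add,
    intervalIntegral.integral_add, intervalIntegral.integral_add, intervalIntegral.integral_sub,
    intervalIntegral.integral_const_mul, intervalIntegral.integral_const_mul,
    intervalIntegral.integral_const_mul, intervalIntegral.integral_const_mul,
    integral_sum₂, integral_sum₂, integral_sum₂, integral_sum₂, integral_sum₂] at hint
  rotate_left
  any_goals first
    | (intro i j; fun_prop)
    | exact Continuous.intervalIntegrable (by fun_prop) _ _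
  simp only [e12, e13, e22, e23, e33] at hint
  rw [sum_symm_eq_two_mul h22 (fun p q => triForm (k22 p q) w),
    sum_symm_eq_two_mul h33 (fun p q => triForm (k33 p q) w)] at hint
  unfold quadForm
  rw [htri]
  linarith

/-! ### Linear differential equations in a Banach algebra -/

section Picard

variable {R : Type*} [NormedRing R] [NormedAlgebra ℝ R]

/-- Picard iterates of `U' = -A U`, `U(0) = 1`. -/
noncomputable def picard (A : ℝ → R) : ℕ → ℝ → R
  | 0 => fun _ => 1
  | n + 1 => fun x => 1 - ∫ ξ in (0 : ℝ)..x, A ξ * picard A n ξ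

variable [CompleteSpace R] {A : ℝ → R}

theorem continuous_primitive_of_continuous {f : ℝ → R} (hf : Continuous f) :
    Continuous fun x => ∫ ξ in (0 : ℝ)..x, f ξ :=
  continuous_iff_continuousAt.2 fun x =>
    (hf.integral_hasStrictDerivAt 0 x).hasDerivAt.continuousAt

theorem continuous_picard (hA : Continuous A) (n : ℕ) : Continuous (picard A n) := by
  induction n with
  | zero => exact continuous_const
  | succ n ih => exact continuous_const.sub (continuous_primitive_of_continuous (hA.mul ih))

/-- Integration against `A` raises the power of x by one and contributes K/(n+1), whence the
factorial. The factor ‖1‖ stays because it need not equal 1: for r = 0 the matrix ring is trivial.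
-/
theorem norm_picard_sub_le (hA : Continuous A) {K : ℝ} (hK0 : 0 ≤ K)
    (hK : ∀ x ∈ Icc (0 : ℝ) 1, ‖A x‖ ≤ K) (n : ℕ) :
    ∀ x ∈ Icc (0 : ℝ) 1, ‖picard A (n + 1) x - picard A n x‖
      ≤ ‖(1 : R)‖ * (K ^ (n + 1) / (n + 1).factorial * x ^ (n + 1)) := by
  have key : ∀ (f : ℝ → R) (c : ℝ) (n : ℕ), (∀ x ∈ Icc (0 : ℝ) 1, ‖f x‖ ≤ c * x ^ n) →
      ∀ x ∈ Icc (0 : ℝ) 1, ‖∫ ξ in (0 : ℝ)..x, A ξ * f ξ‖ ≤ K * c * (x ^ (n + 1) / (n + 1)) := by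
    intro f c n hf x hx
    have h1 : ∫ ξ in (0 : ℝ)..x, K * c * ξ ^ n = K * c * (x ^ (n + 1) / (n + 1)) := by
      rw [intervalIntegral.integral_const_mul, integral_pow]; simp
    rw [← h1]
    refine intervalIntegral.norm_integral_le_of_norm_le hx.1 (ae_of_all _ fun ξ hξ => ?_)
      (Continuous.intervalIntegrable (by fun_prop) _ _)
    have hξ' : ξ ∈ Icc (0 : ℝ) 1 := ⟨hξ.1.le, hξ.2.trans hx.2⟩
    calc ‖A ξ * f ξ‖ ≤ ‖A ξ‖ * ‖f ξ‖ := norm_mul_le _ _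
      _ ≤ K * (c * ξ ^ n) := by gcongr; exacts [hK ξ hξ', hf ξ hξ']
      _ = K * c * ξ ^ n := by ring
  induction n with
  | zero =>
    intro x hx
    have h := key (fun _ => 1) ‖(1 : R)‖ 0 (fun x _ => by simp) x hx
    simp only [picard, sub_sub_cancel_left, norm_neg]
    refine h.trans (le_of_eq ?_)
    simp [Nat.factorial]; ring
  | succ n ih =>
    intro x hx
    have hc := continuous_picard hA
    have h := key (fun x => picard A (n + 1) x - picard A n x)
      (‖(1 : R)‖ * (K ^ (n + 1) / (n + 1).factorial)) (n + 1)
      (fun x hx => (ih x hx).trans (le_of_eq (by ring))) x hx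
    have e : picard A (n + 1 + 1) x - picard A (n + 1) x
        = -∫ ξ in (0 : ℝ)..x, A ξ * (picard A (n + 1) ξ - picard A n ξ) := by
      simp_rw [mul_sub]
      rw [intervalIntegral.integral_sub (Continuous.intervalIntegrable (by fun_prop) _ _)
        (Continuous.intervalIntegrable (by fun_prop) _ _)]
      simp only [picard]
      abel
    rw [e, norm_neg]
    refine h.trans (le_of_eq ?_)
    rw [Nat.factorial_succ (n + 1)]
    push_cast
    field_simp
    ring

/-- The increments are dominated by an exponential series, so the iterates converge uniformly on
[0,1] to a continuous limit `S`, and dominated convergence passes to the limit in the integral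
equation. -/
theorem exists_tendsto_picard (hA : Continuous A) :
    ∃ U : ℝ → R, Continuous U ∧ U 0 = 1 ∧
      (∀ x ∈ Icc (0 : ℝ) 1, Tendsto (fun n => picard A n x) atTop (𝓝 (U x))) ∧
      ∀ x ∈ Icc (0 : ℝ) 1, HasDerivAt U (-(A x * U x)) x := by
  obtain ⟨K, hK⟩ := isCompact_Icc.exists_bound_of_continuousOn
    (hA.continuousOn (s := Icc (0 : ℝ) 1))
  have hK0 : 0 ≤ K := (norm_nonneg _).trans (hK 0 ⟨le_rfl, zero_le_one⟩)
  have hc := continuous_picard hA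
  set u : ℕ → ℝ := fun n => ‖(1 : R)‖ * (K ^ (n + 1) / (n + 1).factorial) with hu
  have hu0 : ∀ n, 0 ≤ u n := fun n => by positivity
  have husum : Summable u :=
    ((summable_nat_add_iff 1).2 (Real.summable_pow_div_factorial K)).mul_left _
  set D : ℕ → ℝ → R := fun n x => picard A (n + 1) x - picard A n x with hD
  have hDu : ∀ n, ∀ x ∈ Icc (0 : ℝ) 1, ‖D n x‖ ≤ u n := fun n x hx =>
    (norm_picard_sub_le hA hK0 hK n x hx).trans (by
      have : x ^ (n + 1) ≤ 1 := pow_le_one₀ hx.1 hx.2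
      simp only [hu]
      gcongr
      exact mul_le_of_le_one_right (by positivity) this)
  have hpart : ∀ n x, picard A n x = 1 + ∑ k ∈ Finset.range n, D k x := by
    intro n x
    simp only [hD, Finset.sum_range_sub (fun k => picard A k x)]
    simp [picard]
  set S : ℝ → R := fun x => 1 + ∑' n, D n x with hS
  have hScont : ContinuousOn S (Icc 0 1) :=
    continuousOn_const.add (continuousOn_tsum
      (fun n => ((hc (n + 1)).sub (hc n)).continuousOn) husum hDu)
  have hlim : ∀ x ∈ Icc (0 : ℝ) 1, Tendsto (fun n => picard A n x) atTop (𝓝 (S x)) := by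
    intro x hx
    simp_rw [hpart]
    exact tendsto_const_nhds.add
      (Summable.of_norm_bounded husum fun n => hDu n x hx).hasSum.tendsto_sum_nat
  have hbd : ∀ n, ∀ x ∈ Icc (0 : ℝ) 1, ‖picard A n x‖ ≤ ‖(1 : R)‖ + ∑' k, u k := by
    intro n x hx
    rw [hpart]
    refine (norm_add_le _ _).trans (add_le_add le_rfl ?_)
    exact (norm_sum_le _ _).trans ((Finset.sum_le_sum fun k _ => hDu k x hx).trans
      (husum.sum_le_tsum _ fun k _ => hu0 k))
  have hproj : Continuous fun x : ℝ => S (projIcc (0 : ℝ) 1 zero_le_one x) :=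
    hScont.comp_continuous (continuous_subtype_val.comp continuous_projIcc) fun x => Subtype.prop _
  have hprojeq : ∀ x ∈ Icc (0 : ℝ) 1, S (projIcc (0 : ℝ) 1 zero_le_one x) = S x := fun x hx => by
    rw [projIcc_of_mem zero_le_one hx]
  -- Extending `S` by its end values makes the integrand continuous on the line, so that `U` has a
  -- two-sided derivative also at 0 and 1.
  set U : ℝ → R := fun x => 1 - ∫ ξ in (0 : ℝ)..x, A ξ * S (projIcc (0 : ℝ) 1 zero_le_one ξ)
    with hU
  have hUS : ∀ x ∈ Icc (0 : ℝ) 1, U x = S x := by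
    intro x hx
    have h1 : Tendsto (fun n => picard A (n + 1) x) atTop (𝓝 (U x)) := by
      refine tendsto_const_nhds.sub ?_
      refine intervalIntegral.tendsto_integral_filter_of_dominated_convergence
        (fun _ => K * (‖(1 : R)‖ + ∑' k, u k))
        (Eventually.of_forall fun n => (hA.mul (hc n)).aestronglyMeasurable)
        (Eventually.of_forall fun n => ae_of_all _ fun ξ hξ => ?_)
        (by simp) (ae_of_all _ fun ξ hξ => ?_)
      · rw [uIoc_of_le hx.1] at hξ
        have hξ' : ξ ∈ Icc (0 : ℝ) 1 := ⟨hξ.1.le, hξ.2.trans hx.2⟩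
        exact (norm_mul_le _ _).trans (mul_le_mul (hK ξ hξ') (hbd n ξ hξ') (norm_nonneg _) hK0)
      · rw [uIoc_of_le hx.1] at hξ
        have hξ' : ξ ∈ Icc (0 : ℝ) 1 := ⟨hξ.1.le, hξ.2.trans hx.2⟩
        rw [hprojeq ξ hξ']
        exact tendsto_const_nhds.mul (hlim ξ hξ')
    exact tendsto_nhds_unique h1 ((hlim x hx).comp (tendsto_add_atTop_nat 1))
  refine ⟨U, continuous_const.sub (continuous_primitive_of_continuous (hA.mul hproj)),
    by simp [hU], fun x hx => hUS x hx ▸ hlim x hx, fun x hx => ?_⟩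
  have h := ((hA.mul hproj).integral_hasStrictDerivAt 0 x).hasDerivAt.const_sub 1
  rw [Pi.mul_apply, hprojeq x hx, ← hUS x hx] at h
  exact h

/-- The inverse solves V' = VA, V(0) = 1. This is the same Picard problem in the opposite algebra
with -A, and then (VU)' = VAU - VAU = 0. -/
theorem exists_tendsto_picard_left_inverse (hA : Continuous A) :
    ∃ U V : ℝ → R, Continuous U ∧ Continuous V ∧ U 0 = 1 ∧
      (∀ x ∈ Icc (0 : ℝ) 1, Tendsto (fun n => picard A n x) atTop (𝓝 (U x))) ∧
      (∀ x ∈ Icc (0 : ℝ) 1, HasDerivAt U (-(A x * U x)) x) ∧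
      ∀ x ∈ Icc (0 : ℝ) 1, V x * U x = 1 := by
  obtain ⟨U, hUc, hU0, hUl, hUd⟩ := exists_tendsto_picard hA
  obtain ⟨W, hWc, hW0, -, hWd⟩ := exists_tendsto_picard (R := Rᵐᵒᵖ)
    (A := fun x => MulOpposite.op (-A x)) (MulOpposite.continuous_op.comp hA.neg)
  refine ⟨U, fun x => (W x).unop, hUc, MulOpposite.continuous_unop.comp hWc, hU0, hUl, hUd, ?_⟩
  have hVd : ∀ x ∈ Icc (0 : ℝ) 1, HasDerivAt (fun x => (W x).unop) ((W x).unop * A x) x := by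
    intro x hx
    have h := ((MulOpposite.opContinuousLinearEquiv ℝ (M := R)).symm.toContinuousLinearMap
      ).hasFDerivAt.comp_hasDerivAt x (hWd x hx)
    refine h.congr_deriv ?_
    change (-(MulOpposite.op (-A x) * W x)).unop = _
    simp
  have hd : ∀ x ∈ Icc (0 : ℝ) 1, HasDerivAt (fun x => (W x).unop * U x) 0 x := by
    intro x hx
    refine ((hVd x hx).mul (hUd x hx)).congr_deriv ?_
    rw [mul_neg, mul_assoc, add_neg_cancel]
  have hconst := constant_of_has_deriv_right_zero (f := fun x => (W x).unop * U x) (a := 0) (b := 1)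
    ((MulOpposite.continuous_unop.comp hWc).mul hUc).continuousOn
    (fun x hx => (hd x ⟨hx.1, hx.2.le⟩).hasDerivWithinAt)
  intro x hx
  rw [hconst x hx]
  simp [hU0, hW0]

end Picard

/-! ### Extension of functions on `[0,1]` to the line -/

/-- The nearest point of `[0,1]`. -/
noncomputable def clamp (x : ℝ) : ℝ := projIcc (0 : ℝ) 1 zero_le_one x

theorem continuous_clamp : Continuous clamp := continuous_subtype_val.comp continuous_projIcc

theorem clamp_mem (x : ℝ) : clamp x ∈ Icc (0 : ℝ) 1 := Subtype.prop _

theorem clamp_of_mem {x : ℝ} (hx : x ∈ Icc (0 : ℝ) 1) : clamp x = x := by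
  simp only [clamp, projIcc_of_mem zero_le_one hx]

theorem continuous_comp_clamp {f : ℝ → ℝ} (hf : ContinuousOn f (Icc 0 1)) :
    Continuous fun x => f (clamp x) :=
  hf.comp_continuous continuous_clamp clamp_mem

/-! ### The fundamental matrix of the inversion formula -/

section Fundamental

attribute [local instance] Matrix.linftyOpNormedRing Matrix.linftyOpNormedAlgebra

variable {ι : Type*} [Fintype ι] [DecidableEq ι]

theorem matrix_integral_apply {f : ℝ → Matrix ι ι ℝ} (hf : Continuous f) (a b : ℝ) (i j : ι) :
    (∫ ξ in a..b, f ξ) i j = ∫ ξ in a..b, f ξ i j := by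
  have h := ((Matrix.entryLinearMap ℝ ℝ i j).toContinuousLinearMap).intervalIntegral_comp_comm
    (hf.intervalIntegrable (μ := volume) a b)
  exact h.symm

theorem hasDerivAt_matrix_apply {f : ℝ → Matrix ι ι ℝ} {f' : Matrix ι ι ℝ} {x : ℝ}
    (hf : HasDerivAt f f' x) (i j : ι) : HasDerivAt (fun y => f y i j) (f' i j) x :=
  ((Matrix.entryLinearMap ℝ ℝ i j).toContinuousLinearMap).hasFDerivAt.comp_hasDerivAt x hf

variable {r : ℕ}

/-- On [0,1] the iterates `invUIter` are Picard iterates for M⁻¹BC, extended continuously by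
clamping; integrals from 0 to x do not see the extension. The matrix norm serves only to supply a
Banach algebra, so the conclusions are stated entrywise. -/
theorem exists_invU {M : ℝ → ℝ} (hM : ContinuousOn M (Icc 0 1)) (hM0 : ∀ x ∈ Icc (0 : ℝ) 1, M x ≠ 0)
    (F G : Fin r → ℝ[X]) :
    ∃ U V : ℝ → Matrix (Fin r ⊕ Fin r) (Fin r ⊕ Fin r) ℝ,
      (∀ i j, Continuous fun x => U x i j) ∧ (∀ i j, Continuous fun x => V x i j) ∧ U 0 = 1 ∧
      (∀ x ∈ Icc (0 : ℝ) 1, invU M F G x = U x) ∧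
      (∀ x ∈ Icc (0 : ℝ) 1, ∀ i j, HasDerivAt (fun y => U y i j)
        (-(invB F G x i * ((M x)⁻¹ * ∑ k, invC F G x k * U x k j))) x) ∧
      ∀ x ∈ Icc (0 : ℝ) 1, V x * U x = 1 := by
  let A : ℝ → Matrix (Fin r ⊕ Fin r) (Fin r ⊕ Fin r) ℝ := fun x =>
    (M (clamp x))⁻¹ • Matrix.vecMulVec (invB F G (clamp x)) (invC F G (clamp x))
  have hA : Continuous A := by
    refine continuous_matrix fun i j => ?_
    have h1 : Continuous fun x => (M (clamp x))⁻¹ :=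
      (continuous_comp_clamp hM).inv₀ fun x => hM0 _ (clamp_mem x)
    have hB : Continuous fun x => invB F G (clamp x) i := by
      rcases i with i | i <;> simp only [invB, Sum.elim_inl, Sum.elim_inr] <;>
        exact (Polynomial.continuous _).comp continuous_clamp
    have hC : Continuous fun x => invC F G (clamp x) j := by
      rcases j with i | i <;> simp only [invC, Sum.elim_inl, Sum.elim_inr]
      · exact (Polynomial.continuous _).comp continuous_clamp
      · exact ((Polynomial.continuous _).comp continuous_clamp).neg
    simp only [A, Matrix.smul_apply, Matrix.vecMulVec_apply, smul_eq_mul]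
    exact h1.mul (hB.mul hC)
  obtain ⟨U, V, hU, hV, hU0, hUl, hUd, hVU⟩ := exists_tendsto_picard_left_inverse hA
  have hiter : ∀ n, ∀ x ∈ Icc (0 : ℝ) 1, invUIter M F G n x = picard A n x := by
    intro n
    induction n with
    | zero => intro x _; rfl
    | succ n ih =>
      intro x hx
      ext i j
      simp only [invUIter, picard, Matrix.sub_apply, Matrix.of_apply]
      rw [matrix_integral_apply (f := fun ξ => A ξ * picard A n ξ) (hA.mul (continuous_picard hA n))]
      congr 1
      refine intervalIntegral.integral_congr fun ξ hξ => ?_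
      rw [uIcc_of_le hx.1] at hξ
      have hξ' : ξ ∈ Icc (0 : ℝ) 1 := ⟨hξ.1, hξ.2.trans hx.2⟩
      simp only [A, clamp_of_mem hξ', ih ξ hξ']
  refine ⟨U, V, fun i j => ?_, fun i j => ?_, hU0, fun x hx => ?_, fun x hx i j => ?_, hVU⟩
  · exact ((Matrix.entryLinearMap ℝ ℝ i j).toContinuousLinearMap).continuous.comp hU
  · exact ((Matrix.entryLinearMap ℝ ℝ i j).toContinuousLinearMap).continuous.comp hV
  · have h := hUl x hx
    simp_rw [← hiter _ x hx] at h
    exact h.limUnder_eq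
  · refine (hasDerivAt_matrix_apply (hUd x hx) i j).congr_deriv ?_
    simp only [A, clamp_of_mem hx, Matrix.neg_apply, Matrix.mul_apply, Matrix.smul_apply,
      Matrix.vecMulVec_apply, smul_eq_mul, Finset.mul_sum]
    congr 1
    exact Finset.sum_congr rfl fun k _ => by ring

end Fundamental

/-! ### Operators with separable kernels -/

section Separable

variable {r : ℕ}

/-- `∑ Fᵢ(x) ∫₀ˣ Gᵢ w`. -/
noncomputable def lowerOp (F G : Fin r → ℝ[X]) (w : ℝ → ℝ) (x : ℝ) : ℝ :=
  ∑ i, (F i).eval x * ∫ ξ in (0 : ℝ)..x, (G i).eval ξ * w ξ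

/-- `∑ Gᵢ(x) ∫ₓ¹ Fᵢ w`. -/
noncomputable def upperOp (F G : Fin r → ℝ[X]) (w : ℝ → ℝ) (x : ℝ) : ℝ :=
  ∑ i, (G i).eval x * ∫ ξ in x..(1 : ℝ), (F i).eval ξ * w ξ

variable {F G : Fin r → ℝ[X]} {u w : ℝ → ℝ}

theorem continuous_eval_mul (p : ℝ[X]) (hw : Continuous w) : Continuous fun ξ => p.eval ξ * w ξ :=
  p.continuous.mul hw

theorem continuous_lowerOp (hw : Continuous w) : Continuous (lowerOp F G w) :=
  continuous_finsetSum _ fun i _ =>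
    (F i).continuous.mul (continuous_integral_left (continuous_eval_mul (G i) hw))

theorem continuous_upperOp (hw : Continuous w) : Continuous (upperOp F G w) :=
  continuous_finsetSum _ fun i _ =>
    (G i).continuous.mul (continuous_integral_right (continuous_eval_mul (F i) hw))

/-- `upperOp F G` is the adjoint of `lowerOp F G` by exchange of the order of integration. This is
the symmetry of 𝒳. -/
theorem integral_mul_upperOp (hu : Continuous u) (hw : Continuous w) :
    ∫ x in (0 : ℝ)..1, u x * upperOp F G w x = ∫ x in (0 : ℝ)..1, w x * lowerOp F G u x := by
  unfold upperOp lowerOp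
  simp_rw [Finset.mul_sum]
  have hl := fun i => continuous_integral_left (continuous_eval_mul (G i) hu)
  have hr := fun i => continuous_integral_right (continuous_eval_mul (F i) hw)
  have hF := fun i => (F i).continuous
  have hG := fun i => (G i).continuous
  rw [intervalIntegral.integral_finsetSum fun i _ => Continuous.intervalIntegrable (by fun_prop) _ _,
    intervalIntegral.integral_finsetSum fun i _ => Continuous.intervalIntegrable (by fun_prop) _ _]
  refine Finset.sum_congr rfl fun i _ => ?_
  have h := integral_triangle_swap (continuous_eval_mul (F i) hw) (continuous_eval_mul (G i) hu)
  refine Eq.trans ?_ (h.symm.trans ?_) <;>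
  exact intervalIntegral.integral_congr fun x _ => by ring

theorem triForm_eq_integral_lowerOp {K : ℝ → ℝ → ℝ}
    (hK : ∀ x ξ, K x ξ = ∑ i, (F i).eval x * (G i).eval ξ) (hw : Continuous w) :
    triForm K w = ∫ x in (0 : ℝ)..1, w x * lowerOp F G w x := by
  refine intervalIntegral.integral_congr fun x _ => ?_
  simp only [hK, lowerOp, Finset.sum_mul, mul_assoc]
  rw [intervalIntegral.integral_finsetSum]
  · simp only [intervalIntegral.integral_const_mul]
  · intro i _
    have := (G i).continuous
    exact Continuous.intervalIntegrable (by fun_prop) _ _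

theorem quadForm_eq_integral {M : ℝ → ℝ} (hM : Continuous M) {K : ℝ → ℝ → ℝ}
    (hK : ∀ x ξ, K x ξ = ∑ i, (F i).eval x * (G i).eval ξ) (hw : Continuous w) :
    quadForm M K w
      = ∫ x in (0 : ℝ)..1, w x * (M x * w x + lowerOp F G w x + upperOp F G w x) := by
  have hl := continuous_lowerOp (F := F) (G := G) hw
  have hu := continuous_upperOp (F := F) (G := G) hw
  unfold quadForm
  rw [triForm_eq_integral_lowerOp hK hw, two_mul]
  nth_rewrite 2 [← integral_mul_upperOp hw hw]
  rw [← intervalIntegral.integral_add (Continuous.intervalIntegrable (by fun_prop) _ _)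
    (Continuous.intervalIntegrable (by fun_prop) _ _),
    ← intervalIntegral.integral_add (Continuous.intervalIntegrable (by fun_prop) _ _)
    (Continuous.intervalIntegrable (by fun_prop) _ _)]
  exact intervalIntegral.integral_congr fun x _ => by ring

theorem eq_zero_of_integral_sq_nonpos (hw : Continuous w)
    (h : ∫ x in (0 : ℝ)..1, w x ^ 2 ≤ 0) : ∀ x ∈ Icc (0 : ℝ) 1, w x = 0 := by
  by_contra hne
  push Not at hne
  obtain ⟨x, hx, hwx⟩ := hne
  have := intervalIntegral.integral_pos zero_lt_one (hw.pow 2).continuousOn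
    (fun y _ => sq_nonneg (w y)) ⟨x, hx, sq_pos_of_ne_zero hwx⟩
  exact absurd h (not_le.2 this)

end Separable

/-! ### Inversion of `𝒳` -/

section Inversion

variable {r : ℕ} {F G : Fin r → ℝ[X]}

/-- If `z' = -B ℓ` and the first half of `z` vanishes at `0`, the second at `1`, then the integral
part of `𝒳 ℓ` is `-C z`. -/
theorem lowerOp_add_upperOp_of_hasDerivAt {z : ℝ → Fin r ⊕ Fin r → ℝ} {ℓ : ℝ → ℝ}
    (hℓ : Continuous ℓ)
    (hz : ∀ x ∈ Icc (0 : ℝ) 1, ∀ i, HasDerivAt (fun y => z y i) (-(invB F G x i * ℓ x)) x)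
    (h0 : ∀ i, z 0 (Sum.inl i) = 0) (h1 : ∀ i, z 1 (Sum.inr i) = 0) {x : ℝ}
    (hx : x ∈ Icc (0 : ℝ) 1) :
    lowerOp F G ℓ x + upperOp F G ℓ x = -(invC F G x ⬝ᵥ z x) := by
  have hl : ∀ i, ∫ ξ in (0 : ℝ)..x, (G i).eval ξ * ℓ ξ = -z x (Sum.inl i) := by
    intro i
    have h := intervalIntegral.integral_eq_sub_of_hasDerivAt (a := 0) (b := x)
      (f := fun y => z y (Sum.inl i)) (f' := fun y => -((G i).eval y * ℓ y))
      (fun y hy => by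
        rw [uIcc_of_le hx.1] at hy
        exact hz y ⟨hy.1, hy.2.trans hx.2⟩ (Sum.inl i))
      ((continuous_eval_mul (G i) hℓ).neg.intervalIntegrable _ _)
    rw [intervalIntegral.integral_neg, h0] at h
    linarith
  have hr : ∀ i, ∫ ξ in x..(1 : ℝ), (F i).eval ξ * ℓ ξ = z x (Sum.inr i) := by
    intro i
    have h := intervalIntegral.integral_eq_sub_of_hasDerivAt (a := x) (b := 1)
      (f := fun y => z y (Sum.inr i)) (f' := fun y => -((F i).eval y * ℓ y))
      (fun y hy => by
        rw [uIcc_of_le hx.2] at hy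
        exact hz y ⟨hx.1.trans hy.1, hy.2⟩ (Sum.inr i))
      ((continuous_eval_mul (F i) hℓ).neg.intervalIntegrable _ _)
    rw [intervalIntegral.integral_neg, h1] at h
    linarith
  simp only [lowerOp, upperOp, hl, hr, dotProduct, invC, Fintype.sum_sum_type, Sum.elim_inl,
    Sum.elim_inr, mul_neg, neg_mul, Finset.sum_neg_distrib]
  ring

theorem continuous_invB (i : Fin r ⊕ Fin r) : Continuous fun x => invB F G x i := by
  rcases i with i | i <;> exact Polynomial.continuous _

theorem continuous_invC (i : Fin r ⊕ Fin r) : Continuous fun x => invC F G x i := by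
  rcases i with i | i
  · exact (F i).continuous
  · exact (G i).continuous.neg

/-- `𝒳` with the inverse multiplier and kernels is a right inverse of `𝒳`, if the latter is
injective. -/
theorem opX_inverse {M : ℝ → ℝ} (hM : Continuous M) (hM0 : ∀ x ∈ Icc (0 : ℝ) 1, M x ≠ 0)
    (hinj : ∀ w : ℝ → ℝ, Continuous w →
      (∀ x ∈ Icc (0 : ℝ) 1, M x * w x + lowerOp F G w x + upperOp F G w x = 0) →
      ∀ x ∈ Icc (0 : ℝ) 1, w x = 0) {g : ℝ → ℝ} (hg : Continuous g) :
    ∃ ℓ : ℝ → ℝ, Continuous ℓ ∧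
      (∀ x ∈ Icc (0 : ℝ) 1, opX (invM M) (invK₁ M F G) (invK₂ M F G) g x = ℓ x) ∧
      ∀ x ∈ Icc (0 : ℝ) 1, M x * ℓ x + lowerOp F G ℓ x + upperOp F G ℓ x = g x := by
  obtain ⟨U, V, hU, hV, hU0, hinvU, hUd, hVU⟩ := exists_invU hM.continuousOn hM0 F G
  have hUV : ∀ x ∈ Icc (0 : ℝ) 1, U x * V x = 1 := fun x hx => mul_eq_one_comm.1 (hVU x hx)
  have hinv : ∀ x ∈ Icc (0 : ℝ) 1, (U x)⁻¹ = V x := fun x hx => Matrix.inv_eq_left_inv (hVU x hx)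
  have m0 : (0 : ℝ) ∈ Icc (0 : ℝ) 1 := ⟨le_rfl, zero_le_one⟩
  have m1 : (1 : ℝ) ∈ Icc (0 : ℝ) 1 := ⟨zero_le_one, le_rfl⟩
  let Mi : ℝ → ℝ := fun x => (M (clamp x))⁻¹
  have hMi : Continuous Mi :=
    (hM.comp continuous_clamp).inv₀ fun x => hM0 _ (clamp_mem x)
  have hMi' : ∀ x ∈ Icc (0 : ℝ) 1, Mi x = (M x)⁻¹ := fun x hx => by
    simp only [Mi, clamp_of_mem hx]
  have hB := continuous_invB (F := F) (G := G)
  have hC := continuous_invC (F := F) (G := G)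
  -- Product rule for U v with U' = -B M⁻¹ C U. A constant v serves for the homogeneous problem, a
  -- varying one for the inhomogeneous problem.
  have mulVec_deriv : ∀ x ∈ Icc (0 : ℝ) 1, ∀ (v : ℝ → Fin r ⊕ Fin r → ℝ) (v' : Fin r ⊕ Fin r → ℝ),
      (∀ i, HasDerivAt (fun y => v y i) (v' i) x) → ∀ i, HasDerivAt (fun y => (U y *ᵥ v y) i)
        (-(invB F G x i * ((M x)⁻¹ * (invC F G x ⬝ᵥ (U x *ᵥ v x)))) + (U x *ᵥ v') i) x := by
    intro x hx v v' hv i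
    simp only [Matrix.mulVec, dotProduct]
    refine (HasDerivAt.fun_sum fun j _ => (hUd x hx i j).mul (hv j)).congr_deriv ?_
    rw [Finset.sum_add_distrib]
    congr 1
    simp only [Finset.mul_sum, Finset.sum_mul, neg_mul, Finset.sum_neg_distrib]
    rw [Finset.sum_comm]
    congr 1
    exact Finset.sum_congr rfl fun j _ => Finset.sum_congr rfl fun k _ => by ring
  -- invertibility of the boundary matrix
  set N : Matrix (Fin r ⊕ Fin r) (Fin r ⊕ Fin r) ℝ :=
    Matrix.fromBlocks 1 0 0 0 + Matrix.fromBlocks 0 0 0 1 * U 1 with hN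
  have hN1 : ∀ v i, ((Matrix.fromBlocks 1 0 0 0 : Matrix (Fin r ⊕ Fin r) (Fin r ⊕ Fin r) ℝ)
      *ᵥ v) (Sum.inl i) = v (Sum.inl i) := by
    intro v i
    simp [Matrix.fromBlocks_mulVec]
  have hN1' : ∀ v i, ((Matrix.fromBlocks 1 0 0 0 : Matrix (Fin r ⊕ Fin r) (Fin r ⊕ Fin r) ℝ)
      *ᵥ v) (Sum.inr i) = 0 := by
    intro v i
    simp [Matrix.fromBlocks_mulVec]
  have hN2 : ∀ v i, ((Matrix.fromBlocks 0 0 0 1 : Matrix (Fin r ⊕ Fin r) (Fin r ⊕ Fin r) ℝ)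
      *ᵥ v) (Sum.inl i) = 0 := by
    intro v i
    simp [Matrix.fromBlocks_mulVec]
  have hN2' : ∀ v i, ((Matrix.fromBlocks 0 0 0 1 : Matrix (Fin r ⊕ Fin r) (Fin r ⊕ Fin r) ℝ)
      *ᵥ v) (Sum.inr i) = v (Sum.inr i) := by
    intro v i
    simp [Matrix.fromBlocks_mulVec]
  -- A null vector v makes z = Uv a solution of the homogeneous boundary value problem. Then ℓ =
  -- M⁻¹Cz satisfies 𝒳ℓ = 0, so ℓ = 0 and z is constant; the conditions at the two ends force v = 0.
  have hdet : N.det ≠ 0 := by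
    intro hdet
    obtain ⟨v, hv0, hv⟩ := Matrix.exists_mulVec_eq_zero_iff.2 hdet
    rw [hN, Matrix.add_mulVec, ← Matrix.mulVec_mulVec] at hv
    have hvl : ∀ i, v (Sum.inl i) = 0 := fun i => by
      have := congrFun hv (Sum.inl i)
      rwa [Pi.add_apply, hN1, hN2, add_zero] at this
    have hvr : ∀ i, (U 1 *ᵥ v) (Sum.inr i) = 0 := fun i => by
      have := congrFun hv (Sum.inr i)
      rwa [Pi.add_apply, hN1', hN2', zero_add] at this
    let ℓ : ℝ → ℝ := fun x => Mi x * (invC F G x ⬝ᵥ (U x *ᵥ v))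
    have hℓ : Continuous ℓ := by
      simp only [ℓ, dotProduct, Matrix.mulVec]
      fun_prop
    have hz : ∀ x ∈ Icc (0 : ℝ) 1, ∀ i,
        HasDerivAt (fun y => (U y *ᵥ v) i) (-(invB F G x i * ℓ x)) x := by
      intro x hx i
      refine (mulVec_deriv x hx (fun _ => v) 0 (fun i => hasDerivAt_const _ _) i).congr_deriv ?_
      simp [ℓ, hMi' x hx]
    have hzero := hinj ℓ hℓ fun x hx => by
      rw [add_assoc, lowerOp_add_upperOp_of_hasDerivAt (z := fun y => U y *ᵥ v) hℓ hz
        (fun i => by simp only [hU0, Matrix.one_mulVec, hvl]) hvr hx]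
      simp only [ℓ, hMi' x hx, mul_inv_cancel_left₀ (hM0 x hx), add_neg_cancel]
    apply hv0
    ext i
    rcases i with i | i
    · exact hvl i
    · have hconst := constant_of_has_deriv_right_zero (f := fun y => (U y *ᵥ v) (Sum.inr i))
        (a := 0) (b := 1)
        (fun x hx => (hz x hx (Sum.inr i)).continuousAt.continuousWithinAt)
        (fun x hx => by
          have h := (hz x ⟨hx.1, hx.2.le⟩ (Sum.inr i)).hasDerivWithinAt (s := Ici x)
          rwa [hzero x ⟨hx.1, hx.2.le⟩, mul_zero, neg_zero] at h)
      have h := hconst 1 m1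
      simp only [hvr, hU0, Matrix.one_mulVec] at h
      exact h.symm
  set H := invH M F G with hH
  have hNH : N * H = Matrix.fromBlocks 0 0 0 1 * U 1 := by
    rw [hH, invH, hinvU 1 m1, ← hN,
      Matrix.mul_nonsing_inv_cancel_left _ _ (isUnit_iff_ne_zero.2 hdet)]
  -- the variation of constants formula
  let ρ : Fin r ⊕ Fin r → ℝ → ℝ := fun i ξ => (V ξ *ᵥ invB F G ξ) i * Mi ξ * g ξ
  have hρ : ∀ i, Continuous (ρ i) := fun i => by
    simp only [ρ, dotProduct, Matrix.mulVec]
    fun_prop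
  let q : ℝ → Fin r ⊕ Fin r → ℝ := fun x i => ∫ ξ in (0 : ℝ)..x, ρ i ξ
  have hq : ∀ i, Continuous fun x => q x i := fun i => continuous_integral_left (hρ i)
  -- This solves z' = -B M⁻¹(Cz + g) with z(0) = H q(1) and z(1) = U(1)(H - I) q(1). The relation
  -- (N₁ + N₂U(1))H = N₂U(1) says exactly that N₁z(0) = 0 and N₂z(1) = 0.
  let z : ℝ → Fin r ⊕ Fin r → ℝ := fun x => U x *ᵥ (H *ᵥ q 1 - q x)
  let ℓ : ℝ → ℝ := fun x => Mi x * (g x + invC F G x ⬝ᵥ z x)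
  have hℓ : Continuous ℓ := by
    simp only [ℓ, z, dotProduct, Matrix.mulVec, Pi.sub_apply]
    fun_prop
  have hz : ∀ x ∈ Icc (0 : ℝ) 1, ∀ i, HasDerivAt (fun y => z y i) (-(invB F G x i * ℓ x)) x := by
    intro x hx i
    refine (mulVec_deriv x hx (fun y => H *ᵥ q 1 - q y) (fun j => -ρ j x)
      (fun j => (hasDerivAt_integral_left (hρ j) x).const_sub _) i).congr_deriv ?_
    have e : (fun j => -ρ j x) = (-(Mi x * g x)) • (V x *ᵥ invB F G x) := by
      ext j
      simp only [ρ, Pi.smul_apply, smul_eq_mul]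
      ring
    rw [e, Matrix.mulVec_smul, Matrix.mulVec_mulVec, hUV x hx, Matrix.one_mulVec]
    simp only [ℓ, z, hMi' x hx, Pi.smul_apply, smul_eq_mul]
    ring
  have hHq : (Matrix.fromBlocks 1 0 0 0 : Matrix (Fin r ⊕ Fin r) (Fin r ⊕ Fin r) ℝ) *ᵥ (H *ᵥ q 1)
      + (Matrix.fromBlocks 0 0 0 1 : Matrix (Fin r ⊕ Fin r) (Fin r ⊕ Fin r) ℝ) *ᵥ (U 1 *ᵥ (H *ᵥ q 1))
      = (Matrix.fromBlocks 0 0 0 1 : Matrix (Fin r ⊕ Fin r) (Fin r ⊕ Fin r) ℝ) *ᵥ (U 1 *ᵥ q 1) := by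
    have h := congrArg (· *ᵥ q 1) hNH
    simp only [hN, ← Matrix.mulVec_mulVec, Matrix.add_mulVec] at h
    exact h
  have hz0 : ∀ i, z 0 (Sum.inl i) = 0 := fun i => by
    have h := congrFun hHq (Sum.inl i)
    rw [Pi.add_apply, hN1, hN2, hN2, add_zero] at h
    have hq0 : q 0 = 0 := by ext j; simp [q]
    simp only [z, hU0, Matrix.one_mulVec, hq0, sub_zero, h]
  have hz1 : ∀ i, z 1 (Sum.inr i) = 0 := fun i => by
    have h := congrFun hHq (Sum.inr i)
    rw [Pi.add_apply, hN1', hN2', hN2', zero_add] at h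
    simp only [z, Matrix.mulVec_sub, Pi.sub_apply, h, sub_self]
  refine ⟨ℓ, hℓ, fun x hx => ?_, fun x hx => ?_⟩
  · have hlow : ∀ (c : Fin r ⊕ Fin r → ℝ) (s t : ℝ),
        ∫ ξ in s..t, c ⬝ᵥ (fun i => ρ i ξ) = c ⬝ᵥ (q t - q s) := by
      intro c s t
      simp only [dotProduct]
      rw [intervalIntegral.integral_finsetSum
        fun i _ => ((hρ i).const_mul _).intervalIntegrable _ _]
      refine Finset.sum_congr rfl fun i _ => ?_
      rw [intervalIntegral.integral_const_mul, Pi.sub_apply,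
        intervalIntegral.integral_interval_sub_left ((hρ i).intervalIntegrable _ _)
          ((hρ i).intervalIntegrable _ _)]
    have hker : ∀ (Q : Matrix (Fin r ⊕ Fin r) (Fin r ⊕ Fin r) ℝ), ∀ ξ ∈ Icc (0 : ℝ) 1,
        (M x)⁻¹ * (invC F G x ⬝ᵥ ((invU M F G x * Q * (invU M F G ξ)⁻¹) *ᵥ invB F G ξ)) * (M ξ)⁻¹
          * g ξ = (M x)⁻¹ * ((invC F G x ᵥ* (U x * Q)) ⬝ᵥ fun i => ρ i ξ) := by
      intro Q ξ hξ
      have e : (fun i => ρ i ξ) = (Mi ξ * g ξ) • (V ξ *ᵥ invB F G ξ) := by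
        ext j
        simp only [ρ, Pi.smul_apply, smul_eq_mul]
        ring
      rw [e, hinvU x hx, hinvU ξ hξ, hinv ξ hξ, dotProduct_smul, ← Matrix.dotProduct_mulVec,
        Matrix.mulVec_mulVec, hMi' ξ hξ, smul_eq_mul]
      ring
    -- As q' = U⁻¹BM⁻¹g, both kernel integrals are increments of q, and (H - I)q(x) + H(q(1) - q(x))
    -- = H q(1) - q(x) recovers z.
    have e1 : ∫ ξ in (0 : ℝ)..x, invK₁ M F G x ξ * g ξ
        = (M x)⁻¹ * ((invC F G x ᵥ* (U x * (H - 1))) ⬝ᵥ (q x - q 0)) := by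
      rw [← hlow, ← intervalIntegral.integral_const_mul]
      refine intervalIntegral.integral_congr fun ξ hξ => ?_
      rw [uIcc_of_le hx.1] at hξ
      exact hker _ ξ ⟨hξ.1, hξ.2.trans hx.2⟩
    have e2 : ∫ ξ in x..(1 : ℝ), invK₂ M F G x ξ * g ξ
        = (M x)⁻¹ * ((invC F G x ᵥ* (U x * H)) ⬝ᵥ (q 1 - q x)) := by
      rw [← hlow, ← intervalIntegral.integral_const_mul]
      refine intervalIntegral.integral_congr fun ξ hξ => ?_
      rw [uIcc_of_le hx.2] at hξ
      exact hker _ ξ ⟨hx.1.trans hξ.1, hξ.2⟩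
    have hq0 : q 0 = 0 := by ext j; simp [q]
    unfold opX
    rw [e1, e2, hq0, sub_zero, ← Matrix.dotProduct_mulVec, ← Matrix.dotProduct_mulVec,
      ← Matrix.mulVec_mulVec, ← Matrix.mulVec_mulVec, Matrix.sub_mulVec, Matrix.one_mulVec]
    simp only [ℓ, z, hMi' x hx, invM, Matrix.mulVec_sub, dotProduct_sub]
    ring
  · rw [add_assoc, lowerOp_add_upperOp_of_hasDerivAt hℓ hz hz0 hz1 hx]
    simp only [ℓ, hMi' x hx, mul_inv_cancel_left₀ (hM0 x hx), add_neg_cancel_right]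

end Inversion

/-! ### The Wirtinger inequality with one vanishing end -/

/-- With h(x) = k cot(k(x+s)) one has the Riccati equation h' = -(k² + h²), and h(1) = 0 by the
choice of k. Integrating (h w²)' gives 0, and (w' - h w)² ≥ 0 is the claim. The shift s > 0 keeps
the cotangent regular at 0; `wirtinger` lets s tend to 0. -/
theorem wirtinger_shifted {w w' : ℝ → ℝ} (hw : Continuous w) (hw' : Continuous w')
    (hd : ∀ x ∈ Ioo (0 : ℝ) 1, HasDerivAt w (w' x) x) (h0 : w 0 = 0) {s : ℝ} (hs : 0 < s) :
    (Real.pi / (2 * (1 + s))) ^ 2 * ∫ x in (0 : ℝ)..1, w x ^ 2 ≤ ∫ x in (0 : ℝ)..1, w' x ^ 2 := by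
  set k := Real.pi / (2 * (1 + s)) with hk
  have hkpos : 0 < k := by positivity
  have hk1 : k * (1 + s) = Real.pi / 2 := by rw [hk]; field_simp
  have hsin : ∀ x ∈ Icc (0 : ℝ) 1, Real.sin (k * (x + s)) ≠ 0 := by
    intro x hx
    refine (Real.sin_pos_of_pos_of_lt_pi (by have := hx.1; positivity) ?_).ne'
    have : k * (x + s) ≤ k * (1 + s) := by gcongr; exact hx.2
    linarith [Real.pi_pos]
  set h : ℝ → ℝ := fun x => k * (Real.cos (k * (x + s)) / Real.sin (k * (x + s))) with hh
  have hhc : ContinuousOn h (Icc 0 1) := by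
    refine continuousOn_const.mul (ContinuousOn.div ?_ ?_ hsin) <;> fun_prop
  have hhd : ∀ x ∈ Icc (0 : ℝ) 1, HasDerivAt h (-(k ^ 2 + h x ^ 2)) x := by
    intro x hx
    have hθ : HasDerivAt (fun x => k * (x + s)) k x := by
      simpa using ((hasDerivAt_id x).add_const s).const_mul k
    refine ((hθ.cos.div hθ.sin (hsin x hx)).const_mul k).congr_deriv ?_
    have := hsin x hx
    simp only [hh]
    field_simp
    ring
  have hΦ : ∫ x in (0 : ℝ)..1, (-(k ^ 2 + h x ^ 2) * w x ^ 2 + h x * (2 * w x * w' x)) = 0 := by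
    rw [intervalIntegral.integral_eq_sub_of_hasDerivAt_of_le (f := fun x => h x * w x ^ 2)
      zero_le_one (hhc.mul (hw.pow 2).continuousOn) (fun x hx => ?_)]
    · have h1 : h 1 = 0 := by simp only [hh, hk1, Real.cos_pi_div_two, zero_div, mul_zero]
      simp [h1, h0]
    · refine ContinuousOn.intervalIntegrable_of_Icc zero_le_one ?_
      fun_prop
    · refine ((hhd x ⟨hx.1.le, hx.2.le⟩).mul ((hd x hx).pow 2)).congr_deriv ?_
      simp
  have hmono : ∫ x in (0 : ℝ)..1, (-(k ^ 2 + h x ^ 2) * w x ^ 2 + h x * (2 * w x * w' x))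
      ≤ ∫ x in (0 : ℝ)..1, (w' x ^ 2 - k ^ 2 * w x ^ 2) := by
    refine intervalIntegral.integral_mono_on zero_le_one ?_ ?_ fun x _ => ?_
    · refine ContinuousOn.intervalIntegrable_of_Icc zero_le_one ?_
      fun_prop
    · exact Continuous.intervalIntegrable (by fun_prop) _ _
    · nlinarith [sq_nonneg (w' x - h x * w x)]
  rw [hΦ, intervalIntegral.integral_sub (Continuous.intervalIntegrable (by fun_prop) _ _)
    (Continuous.intervalIntegrable (by fun_prop) _ _), intervalIntegral.integral_const_mul] at hmono
  linarith

theorem wirtinger {w w' : ℝ → ℝ} (hw : Continuous w) (hw' : Continuous w')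
    (hd : ∀ x ∈ Ioo (0 : ℝ) 1, HasDerivAt w (w' x) x) (h0 : w 0 = 0) :
    Real.pi ^ 2 / 4 * ∫ x in (0 : ℝ)..1, w x ^ 2 ≤ ∫ x in (0 : ℝ)..1, w' x ^ 2 := by
  have hlim : Tendsto (fun s : ℝ => (Real.pi / (2 * (1 + s))) ^ 2 * ∫ x in (0 : ℝ)..1, w x ^ 2)
      (𝓝[>] 0) (𝓝 ((Real.pi / (2 * (1 + 0))) ^ 2 * ∫ x in (0 : ℝ)..1, w x ^ 2)) := by
    refine Tendsto.mono_left (ContinuousAt.tendsto ?_) nhdsWithin_le_nhds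
    refine ContinuousAt.mul (ContinuousAt.pow (continuousAt_const.div (by fun_prop) ?_) 2)
      continuousAt_const
    norm_num
  have h := le_of_tendsto hlim (eventually_mem_nhdsWithin.mono fun s hs =>
    wirtinger_shifted hw hw' hd h0 hs)
  refine le_trans (le_of_eq ?_) h
  ring

/-! ### The dissipation inequality -/

section Dissipation

variable {r : ℕ} {F G : Fin r → ℝ[X]} {w : ℝ → ℝ}

theorem hasDerivAt_lowerOp (hw : Continuous w) (x : ℝ) :
    HasDerivAt (lowerOp F G w) (lowerOp (fun i => (F i).derivative) G w x
      + (∑ i, (F i).eval x * (G i).eval x) * w x) x := by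
  have h := HasDerivAt.fun_sum (u := Finset.univ) fun i _ =>
    ((F i).hasDerivAt x).mul (hasDerivAt_integral_left (continuous_eval_mul (G i) hw) x)
  refine h.congr_deriv ?_
  rw [Finset.sum_add_distrib, Finset.sum_mul]
  simp only [lowerOp, mul_assoc]

theorem hasDerivAt_upperOp (hw : Continuous w) (x : ℝ) :
    HasDerivAt (upperOp F G w) (upperOp F (fun i => (G i).derivative) w x
      - (∑ i, (F i).eval x * (G i).eval x) * w x) x := by
  have h := HasDerivAt.fun_sum (u := Finset.univ) fun i _ =>
    ((G i).hasDerivAt x).mul (hasDerivAt_integral_right (continuous_eval_mul (F i) hw) x)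
  refine h.congr_deriv ?_
  rw [Finset.sum_add_distrib, Finset.sum_mul, sub_eq_add_neg, ← Finset.sum_neg_distrib]
  simp only [upperOp]
  congr 1
  exact Finset.sum_congr rfl fun i _ => by ring

theorem eval_mul_lowerOp (p : ℝ[X]) (x : ℝ) :
    p.eval x * lowerOp F G w x = lowerOp (fun i => p * F i) G w x := by
  simp only [lowerOp, Finset.mul_sum, Polynomial.eval_mul, mul_assoc]

theorem eval_mul_upperOp (p : ℝ[X]) (x : ℝ) :
    p.eval x * upperOp F G w x = upperOp F (fun i => p * G i) w x := by
  simp only [upperOp, Finset.mul_sum, Polynomial.eval_mul, mul_assoc]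

/-- The formal adjoint `(a p)'' - (b p)' + c p` of `a ∂² + b ∂ + c`. -/
noncomputable def adjointPoly (a b c p : ℝ[X]) : ℝ[X] :=
  (a * p).derivative.derivative - (b * p).derivative + c * p

/-- Half of the jump that the kernel contributes to the multiplier. -/
noncomputable def jumpPoly (a : ℝ[X]) (F G : Fin r → ℝ[X]) : ℝ[X] :=
  ∑ i, ((a * F i).derivative * G i - F i * (a * G i).derivative)

variable (a b c M : ℝ[X]) {w' w'' : ℝ → ℝ}

/-- Integrate the derivative of 2aM w w' + (bM - (aM)') w²; its value at 0 vanishes with w(0). -/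
theorem integral_multiplier_part (hw : Continuous w) (hw' : Continuous w') (hw'' : Continuous w'')
    (hd : ∀ x ∈ Ioo (0 : ℝ) 1, HasDerivAt w (w' x) x)
    (hd' : ∀ x ∈ Ioo (0 : ℝ) 1, HasDerivAt w' (w'' x) x) (h0 : w 0 = 0) :
    2 * ∫ x in (0 : ℝ)..1, M.eval x * w x * (a.eval x * w'' x + b.eval x * w' x + c.eval x * w x)
      = (2 * (a.eval 1 * M.eval 1) * (w 1 * w' 1)
          + ((b * M).eval 1 - (a * M).derivative.eval 1) * w 1 ^ 2)
        + (∫ x in (0 : ℝ)..1, ((a * M).derivative.derivative.eval x - (b * M).derivative.eval x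
            + 2 * (M.eval x * c.eval x)) * w x ^ 2)
        - 2 * ∫ x in (0 : ℝ)..1, a.eval x * M.eval x * w' x ^ 2 := by
  have ca := a.continuous
  have cb := b.continuous
  have cc := c.continuous
  have cM := M.continuous
  have c1 := (a * M).derivative.derivative.continuous
  have c1' := (a * M).derivative.continuous
  have c1'' := (a * M).continuous
  have c2 := (b * M).derivative.continuous
  have c2' := (b * M).continuous
  have hFTC := intervalIntegral.integral_eq_sub_of_hasDerivAt_of_le (a := 0) (b := 1)
    (f := fun x => 2 * ((a * M).eval x * (w x * w' x))
      + ((b * M).eval x - (a * M).derivative.eval x) * w x ^ 2)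
    (f' := fun x => 2 * ((a * M).derivative.eval x * (w x * w' x)
        + (a * M).eval x * (w' x * w' x + w x * w'' x))
      + (((b * M).derivative.eval x - (a * M).derivative.derivative.eval x) * w x ^ 2
        + ((b * M).eval x - (a * M).derivative.eval x) * (2 * w x * w' x)))
    zero_le_one (Continuous.continuousOn (by fun_prop))
    (fun x hx => by
      refine (((((a * M).hasDerivAt x).mul ((hd x hx).mul (hd' x hx))).const_mul 2).add
        ((((b * M).hasDerivAt x).sub ((a * M).derivative.hasDerivAt x)).mul
          ((hd x hx).pow 2))).congr_deriv ?_
      simp)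
    (Continuous.intervalIntegrable (by fun_prop) _ _)
  have e : 2 * ∫ x in (0 : ℝ)..1,
        M.eval x * w x * (a.eval x * w'' x + b.eval x * w' x + c.eval x * w x)
      = (∫ x in (0 : ℝ)..1, (2 * ((a * M).derivative.eval x * (w x * w' x)
        + (a * M).eval x * (w' x * w' x + w x * w'' x))
      + (((b * M).derivative.eval x - (a * M).derivative.derivative.eval x) * w x ^ 2
        + ((b * M).eval x - (a * M).derivative.eval x) * (2 * w x * w' x))))
        + (∫ x in (0 : ℝ)..1, ((a * M).derivative.derivative.eval x - (b * M).derivative.eval x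
            + 2 * (M.eval x * c.eval x)) * w x ^ 2)
        - 2 * ∫ x in (0 : ℝ)..1, a.eval x * M.eval x * w' x ^ 2 := by
    rw [← intervalIntegral.integral_const_mul, ← intervalIntegral.integral_const_mul,
      ← intervalIntegral.integral_add (Continuous.intervalIntegrable (by fun_prop) _ _)
      (Continuous.intervalIntegrable (by fun_prop) _ _),
      ← intervalIntegral.integral_sub (Continuous.intervalIntegrable (by fun_prop) _ _)
      (Continuous.intervalIntegrable (by fun_prop) _ _)]
    refine intervalIntegral.integral_congr fun x _ => ?_
    simp only [Polynomial.eval_mul]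
    ring
  rw [e, hFTC]
  simp only [h0, Polynomial.eval_mul]
  ring

/-- With k the integral part of 𝒳w, integrate the derivative of (ak)w' - (ak)'w + bkw. The kernel is
continuous across the diagonal, so (ak)' has no diagonal term; its normal derivative jumps, so
(ak)'' acquires `jumpPoly` times w. -/
theorem integral_kernel_part (hw : Continuous w) (hw' : Continuous w') (hw'' : Continuous w'')
    (hd : ∀ x ∈ Ioo (0 : ℝ) 1, HasDerivAt w (w' x) x)
    (hd' : ∀ x ∈ Ioo (0 : ℝ) 1, HasDerivAt w' (w'' x) x) (h0 : w 0 = 0)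
    (hK0 : ∀ ξ, ∑ i, (F i).eval ξ * (G i).eval 0 = 0) :
    ∫ x in (0 : ℝ)..1, (lowerOp F G w x + upperOp F G w x)
        * (a.eval x * w'' x + b.eval x * w' x + c.eval x * w x)
      = (∑ i, (a.eval 1 * (F i).eval 1 * w' 1 - (a * F i).derivative.eval 1 * w 1
            + b.eval 1 * (F i).eval 1 * w 1) * ∫ ξ in (0 : ℝ)..1, (G i).eval ξ * w ξ)
        + (∫ x in (0 : ℝ)..1, w x * lowerOp (fun i => adjointPoly a b c (F i)) G w x)
        + (∫ x in (0 : ℝ)..1, w x * lowerOp F (fun i => adjointPoly a b c (G i)) w x)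
        + ∫ x in (0 : ℝ)..1, (jumpPoly a F G).eval x * w x ^ 2 := by
  have ca := a.continuous
  have cb := b.continuous
  have cc := c.continuous
  have cj := (jumpPoly a F G).continuous
  have cl : ∀ F G : Fin r → ℝ[X], Continuous (lowerOp F G w) := fun F G => continuous_lowerOp hw
  have cu : ∀ F G : Fin r → ℝ[X], Continuous (upperOp F G w) := fun F G => continuous_upperOp hw
  -- `p k` and its derivatives
  let k : ℝ[X] → ℝ → ℝ := fun p x =>
    lowerOp (fun i => p * F i) G w x + upperOp F (fun i => p * G i) w x
  let k' : ℝ[X] → ℝ → ℝ := fun p x => lowerOp (fun i => (p * F i).derivative) G w x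
    + upperOp F (fun i => (p * G i).derivative) w x
  let k'' : ℝ[X] → ℝ → ℝ := fun p x => lowerOp (fun i => (p * F i).derivative.derivative) G w x
    + upperOp F (fun i => (p * G i).derivative.derivative) w x + (jumpPoly p F G).eval x * w x
  have hk : ∀ p x, p.eval x * (lowerOp F G w x + upperOp F G w x) = k p x := fun p x => by
    simp only [k, mul_add, eval_mul_lowerOp, eval_mul_upperOp]
  have ck : ∀ p, Continuous (k p) := fun p => (cl _ _).add (cu _ _)
  have ck' : ∀ p, Continuous (k' p) := fun p => (cl _ _).add (cu _ _)
  have ck'' : ∀ p, Continuous (k'' p) := fun p =>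
    ((cl _ _).add (cu _ _)).add ((jumpPoly p F G).continuous.mul hw)
  have dk : ∀ p x, HasDerivAt (k p) (k' p x) x := by
    intro p x
    refine ((hasDerivAt_lowerOp hw x).add (hasDerivAt_upperOp hw x)).congr_deriv ?_
    -- The diagonal contributions of the lower and the upper part cancel.
    have e : ∑ i, (p * F i).eval x * (G i).eval x = ∑ i, (F i).eval x * (p * G i).eval x :=
      Finset.sum_congr rfl fun i _ => by simp only [Polynomial.eval_mul]; ring
    simp only [k', e]
    ring
  have dk' : ∀ p x, HasDerivAt (k' p) (k'' p x) x := by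
    intro p x
    refine ((hasDerivAt_lowerOp hw x).add (hasDerivAt_upperOp hw x)).congr_deriv ?_
    simp only [k'', jumpPoly, Polynomial.eval_finsetSum, Polynomial.eval_sub, Polynomial.eval_mul,
      Finset.sum_sub_distrib]
    ring
  have hFTC := intervalIntegral.integral_eq_sub_of_hasDerivAt_of_le (a := 0) (b := 1)
    (f := fun x => k a x * w' x - k' a x * w x + k b x * w x)
    (f' := fun x => (k' a x * w' x + k a x * w'' x) - (k'' a x * w x + k' a x * w' x)
      + (k' b x * w x + k b x * w' x))
    zero_le_one (Continuous.continuousOn (by fun_prop))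
    (fun x hx => (((dk a x).mul (hd' x hx)).sub ((dk' a x).mul (hd x hx))).add
        ((dk b x).mul (hd x hx)))
    (Continuous.intervalIntegrable (by fun_prop) _ _)
  -- Nothing is known about w'(0), so its coefficient must vanish; this is the role of K₂(0,·) = 0.
  have hk0 : k a 0 = 0 := by
    have hF := fun i => (F i).continuous
    rw [← hk]
    have : lowerOp F G w 0 + upperOp F G w 0 = 0 := by
      simp only [lowerOp, upperOp, intervalIntegral.integral_same, mul_zero, Finset.sum_const_zero,
        zero_add, ← intervalIntegral.integral_const_mul]
      rw [← intervalIntegral.integral_finsetSum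
        fun i _ => Continuous.intervalIntegrable (by fun_prop) _ _]
      refine (intervalIntegral.integral_congr (g := fun _ => 0) fun ξ _ => ?_).trans (by simp)
      have e : ∑ i, (G i).eval 0 * ((F i).eval ξ * w ξ)
          = (∑ i, (F i).eval ξ * (G i).eval 0) * w ξ := by
        rw [Finset.sum_mul]
        exact Finset.sum_congr rfl fun i _ => by ring
      simp only [e, hK0, zero_mul]
    rw [this, mul_zero]
  have hb1 : k a 1 * w' 1 - k' a 1 * w 1 + k b 1 * w 1
      = ∑ i, (a.eval 1 * (F i).eval 1 * w' 1 - (a * F i).derivative.eval 1 * w 1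
            + b.eval 1 * (F i).eval 1 * w 1) * ∫ ξ in (0 : ℝ)..1, (G i).eval ξ * w ξ := by
    simp only [k, k', lowerOp, upperOp, intervalIntegral.integral_same, mul_zero,
      add_zero, Finset.sum_mul, ← Finset.sum_sub_distrib,
      ← Finset.sum_add_distrib, Polynomial.eval_mul]
    exact Finset.sum_congr rfl fun i _ => by ring
  rw [hk0, h0, hb1] at hFTC
  have hadj := integral_mul_upperOp (F := F) (G := fun i => adjointPoly a b c (G i)) hw hw
  rw [← hadj]
  have cl1 := cl (fun i => adjointPoly a b c (F i)) G
  have cu1 := cu F (fun i => adjointPoly a b c (G i))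
  have hsplit : ∀ x, lowerOp (fun i => adjointPoly a b c (F i)) G w x
      + upperOp F (fun i => adjointPoly a b c (G i)) w x + (jumpPoly a F G).eval x * w x
      = k'' a x - k' b x + k c x := by
    intro x
    simp only [k, k', k'', lowerOp, upperOp, adjointPoly, Polynomial.eval_add, Polynomial.eval_sub,
      add_mul, sub_mul, Finset.sum_add_distrib, Finset.sum_sub_distrib]
    ring
  have hS : ∑ i, (a.eval 1 * (F i).eval 1 * w' 1 - (a * F i).derivative.eval 1 * w 1
        + b.eval 1 * (F i).eval 1 * w 1) * ∫ ξ in (0 : ℝ)..1, (G i).eval ξ * w ξ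
      = ∫ x in (0 : ℝ)..1, ((k' a x * w' x + k a x * w'' x) - (k'' a x * w x + k' a x * w' x)
      + (k' b x * w x + k b x * w' x)) := by
    rw [hFTC]; ring
  rw [hS, ← intervalIntegral.integral_add (Continuous.intervalIntegrable (by fun_prop) _ _)
      (Continuous.intervalIntegrable (by fun_prop) _ _),
    ← intervalIntegral.integral_add (Continuous.intervalIntegrable (by fun_prop) _ _)
      (Continuous.intervalIntegrable (by fun_prop) _ _),
    ← intervalIntegral.integral_add (Continuous.intervalIntegrable (by fun_prop) _ _)
      (Continuous.intervalIntegrable (by fun_prop) _ _)]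
  refine intervalIntegral.integral_congr fun x _ => ?_
  have h1 := hsplit x
  have ha := hk a x
  have hb := hk b x
  have hc := hk c x
  linear_combination (-w x) * h1 + w'' x * ha + w' x * hb + w x * hc

end Dissipation

/-! ### The map `Ω_s` on separable kernels and the resulting inequality -/

section Omega

variable {r : ℕ} {F G : Fin r → ℝ[X]} {K₁ K₂ : ℝ → ℝ → ℝ} (a b c M : ℝ[X])

theorem derivative_mul_C (p : ℝ[X]) (s : ℝ) : (p * C s).derivative = p.derivative * C s := by
  simp

theorem eval_mul_C (p : ℝ[X]) (s x : ℝ) : (p * C s).eval x = p.eval x * s := by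
  simp

theorem deriv_adjoint (p : ℝ[X]) (x : ℝ) :
    deriv (fun y => deriv (fun z => a.eval z * p.eval z) y - b.eval y * p.eval y) x
      = (a * p).derivative.derivative.eval x - (b * p).derivative.eval x := by
  simp only [← Polynomial.eval_mul, ← Polynomial.eval_sub, Polynomial.deriv,
    Polynomial.derivative_sub]

/-- K₁(y,x) - K₂(y,x) is differentiated in y with x frozen, so the factors evaluated at x act as
constants. The result is the jump that appears in `integral_kernel_part`. -/
theorem OmegaM_eq (hK : ∀ x ξ, K₁ x ξ = ∑ i, (F i).eval x * (G i).eval ξ)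
    (hK₂ : ∀ x ξ, K₂ x ξ = K₁ ξ x) (α ε x : ℝ) :
    OmegaM (fun x => a.eval x) (fun x => b.eval x) (fun x => c.eval x) α ε (fun x => M.eval x)
        K₁ K₂ x
      = ((a * M).derivative.derivative.eval x - (b * M).derivative.eval x
          + 2 * (M.eval x * c.eval x)) + 2 * (jumpPoly a F G).eval x
        - Real.pi ^ 2 / 2 * α * ε := by
  have h : deriv (fun y => a.eval y * (K₁ y x - K₂ y x)) x = (jumpPoly a F G).eval x := by
    have e : (fun y => a.eval y * (K₁ y x - K₂ y x)) = fun y =>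
        (∑ i, (a * F i * C ((G i).eval x) - C ((F i).eval x) * (a * G i))).eval y := by
      ext y
      simp only [hK₂, hK, ← Finset.sum_sub_distrib, Finset.mul_sum, Polynomial.eval_finsetSum,
        Polynomial.eval_sub, Polynomial.eval_mul, Polynomial.eval_C]
      exact Finset.sum_congr rfl fun i _ => by ring
    rw [e, Polynomial.deriv]
    simp only [jumpPoly, Polynomial.derivative_sum, Polynomial.eval_finsetSum,
      Polynomial.derivative_sub, Polynomial.eval_sub, derivative_mul_C,
      Polynomial.derivative_C_mul, Polynomial.eval_mul, Polynomial.eval_C]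
  unfold OmegaM
  rw [deriv_adjoint, h]
  ring

theorem OmegaK₁_eq (hK : ∀ x ξ, K₁ x ξ = ∑ i, (F i).eval x * (G i).eval ξ) (x ξ : ℝ) :
    OmegaK₁ (fun x => a.eval x) (fun x => b.eval x) (fun x => c.eval x) K₁ x ξ
      = (∑ i, (adjointPoly a b c (F i)).eval x * (G i).eval ξ)
        + ∑ i, (F i).eval x * (adjointPoly a b c (G i)).eval ξ := by
  have h1 : ∀ z, K₁ z ξ = (∑ i, F i * C ((G i).eval ξ)).eval z := fun z => by
    simp [hK, Polynomial.eval_finsetSum]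
  have h2 : ∀ z, K₁ x z = (∑ i, C ((F i).eval x) * G i).eval z := fun z => by
    simp [hK, Polynomial.eval_finsetSum]
  have h3 : (c.eval x + c.eval ξ) * K₁ x ξ = (∑ i, (c * F i).eval x * (G i).eval ξ)
      + ∑ i, (F i).eval x * (c * G i).eval ξ := by
    rw [hK, Finset.mul_sum, ← Finset.sum_add_distrib]
    exact Finset.sum_congr rfl fun i _ => by simp only [Polynomial.eval_mul]; ring
  unfold OmegaK₁
  rw [h3]
  simp only [h1, h2]
  rw [deriv_adjoint, deriv_adjoint]
  have e : ∀ p q : ℝ[X], ∀ s : ℝ, p * (q * C s) = p * q * C s := fun p q s => by ring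
  have e' : ∀ p q : ℝ[X], ∀ s : ℝ, p * (C s * q) = C s * (p * q) := fun p q s => by ring
  simp only [Finset.mul_sum, e, e', Polynomial.derivative_sum, derivative_mul_C,
    Polynomial.derivative_C_mul, Polynomial.eval_finsetSum, eval_mul_C,
    Polynomial.eval_C_mul, adjointPoly, Polynomial.eval_add, Polynomial.eval_sub, add_mul, sub_mul,
    mul_add, mul_sub, Finset.sum_add_distrib, Finset.sum_sub_distrib]
  ring

theorem continuous_separable {K : ℝ → ℝ → ℝ} {F G : Fin r → ℝ[X]}
    (hK : ∀ x ξ, K x ξ = ∑ i, (F i).eval x * (G i).eval ξ) : Continuous (Function.uncurry K) := by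
  have e : Function.uncurry K = fun p => ∑ i, (F i).eval p.1 * (G i).eval p.2 := by
    ext ⟨x, ξ⟩; exact hK x ξ
  rw [e]
  exact continuous_finsetSum _ fun i _ => ((F i).continuous.comp continuous_fst).mul
    ((G i).continuous.comp continuous_snd)

theorem continuous_OmegaK₁ (hK : ∀ x ξ, K₁ x ξ = ∑ i, (F i).eval x * (G i).eval ξ) :
    Continuous (Function.uncurry
      (OmegaK₁ (fun x => a.eval x) (fun x => b.eval x) (fun x => c.eval x) K₁)) := by
  rw [funext fun x => funext fun ξ => OmegaK₁_eq a b c hK x ξ]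
  exact (continuous_separable (K := fun x ξ => ∑ i, (adjointPoly a b c (F i)).eval x * (G i).eval ξ)
    fun _ _ => rfl).add (continuous_separable
      (K := fun x ξ => ∑ i, (F i).eval x * (adjointPoly a b c (G i)).eval ξ) fun _ _ => rfl)

/-- The two integrations by parts are added; the injection `ℓ` cancels the nonlocal boundary term,
`hbd` disposes of the local one, and Wirtinger's inequality absorbs ∫aM w'². -/
theorem dissipation_inequality {α ε L₂ : ℝ} (hα : 0 < α) (hε : 0 < ε)
    (ha : ∀ x ∈ Icc (0 : ℝ) 1, α ≤ a.eval x) (hMε : ∀ x, ε ≤ M.eval x)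
    (hK : ∀ x ξ, K₁ x ξ = ∑ i, (F i).eval x * (G i).eval ξ) (hK₂ : ∀ x ξ, K₂ x ξ = K₁ ξ x)
    (hK0 : ∀ ξ, K₂ 0 ξ = 0)
    (hbd : 2 * (a.eval 1 * M.eval 1) * L₂ + ((b * M).eval 1 - (a * M).derivative.eval 1) ≤ 0)
    {ℓ g : ℝ → ℝ} (hℓ : Continuous ℓ)
    (hℓg : ∀ x ∈ Icc (0 : ℝ) 1, M.eval x * ℓ x + lowerOp F G ℓ x + upperOp F G ℓ x = g x)
    (hg : ∀ ξ, g ξ = -∑ i, (a.eval 1 * (F i).eval 1 * L₂ - (a * F i).derivative.eval 1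
      + b.eval 1 * (F i).eval 1) * (G i).eval ξ)
    {w w' w'' : ℝ → ℝ} (hw : Continuous w) (hw' : Continuous w') (hw'' : Continuous w'')
    (hd : ∀ x ∈ Ioo (0 : ℝ) 1, HasDerivAt w (w' x) x)
    (hd' : ∀ x ∈ Ioo (0 : ℝ) 1, HasDerivAt w' (w'' x) x) (h0 : w 0 = 0) (h1 : w' 1 = L₂ * w 1) :
    2 * ∫ x in (0 : ℝ)..1, (M.eval x * w x + lowerOp F G w x + upperOp F G w x)
        * (a.eval x * w'' x + b.eval x * w' x + c.eval x * w x + ℓ x * w 1)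
      ≤ quadForm (OmegaM (fun x => a.eval x) (fun x => b.eval x) (fun x => c.eval x) α ε
          (fun x => M.eval x) K₁ K₂)
        (OmegaK₁ (fun x => a.eval x) (fun x => b.eval x) (fun x => c.eval x) K₁) w := by
  have ca := a.continuous
  have cb := b.continuous
  have cc := c.continuous
  have cM := M.continuous
  have cj := (jumpPoly a F G).continuous
  have c1 := (a * M).derivative.derivative.continuous
  have c2 := (b * M).derivative.continuous
  have cG := fun i => (G i).continuous
  have cl : ∀ (F G : Fin r → ℝ[X]) {w : ℝ → ℝ}, Continuous w → Continuous (lowerOp F G w) :=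
    fun F G _ hw => continuous_lowerOp hw
  have cu : ∀ (F G : Fin r → ℝ[X]) {w : ℝ → ℝ}, Continuous w → Continuous (upperOp F G w) :=
    fun F G _ hw => continuous_upperOp hw
  have clw := cl F G hw
  have cuw := cu F G hw
  have cll := cl F G hℓ
  have cul := cu F G hℓ
  have hmult := integral_multiplier_part a b c M hw hw' hw'' hd hd' h0
  have hker := integral_kernel_part (F := F) (G := G) a b c hw hw' hw'' hd hd' h0 fun ξ => by
    rw [← hK, ← hK₂, hK0]
  -- the output injection term
  have hinj : ∫ x in (0 : ℝ)..1, (M.eval x * w x + lowerOp F G w x + upperOp F G w x) * ℓ x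
      = ∫ x in (0 : ℝ)..1, g x * w x := by
    have e1 := integral_mul_upperOp (F := F) (G := G) hℓ hw
    have e2 := integral_mul_upperOp (F := F) (G := G) hw hℓ
    calc _ = (∫ x in (0 : ℝ)..1, M.eval x * w x * ℓ x) + (∫ x in (0 : ℝ)..1, ℓ x * lowerOp F G w x)
          + ∫ x in (0 : ℝ)..1, ℓ x * upperOp F G w x := by
          rw [← intervalIntegral.integral_add (Continuous.intervalIntegrable (by fun_prop) _ _)
            (Continuous.intervalIntegrable (by fun_prop) _ _),
            ← intervalIntegral.integral_add (Continuous.intervalIntegrable (by fun_prop) _ _)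
            (Continuous.intervalIntegrable (by fun_prop) _ _)]
          exact intervalIntegral.integral_congr fun x _ => by ring
      _ = (∫ x in (0 : ℝ)..1, M.eval x * w x * ℓ x) + (∫ x in (0 : ℝ)..1, w x * lowerOp F G ℓ x)
          + ∫ x in (0 : ℝ)..1, w x * upperOp F G ℓ x := by rw [e1, e2]; ring
      _ = _ := by
          rw [← intervalIntegral.integral_add (Continuous.intervalIntegrable (by fun_prop) _ _)
            (Continuous.intervalIntegrable (by fun_prop) _ _),
            ← intervalIntegral.integral_add (Continuous.intervalIntegrable (by fun_prop) _ _)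
            (Continuous.intervalIntegrable (by fun_prop) _ _)]
          refine intervalIntegral.integral_congr fun x hx => ?_
          rw [uIcc_of_le zero_le_one] at hx
          rw [← hℓg x hx]
          ring
  -- With w'(1) = L₂w(1) the boundary term of the kernel is -w(1)⟨g, w⟩, opposite to the injection
  -- term w(1)⟨𝒳w, ℓ⟩.
  have hgw : ∑ i, (a.eval 1 * (F i).eval 1 * w' 1 - (a * F i).derivative.eval 1 * w 1
        + b.eval 1 * (F i).eval 1 * w 1) * ∫ ξ in (0 : ℝ)..1, (G i).eval ξ * w ξ
      = -(w 1 * ∫ x in (0 : ℝ)..1, g x * w x) := by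
    simp only [hg, neg_mul, intervalIntegral.integral_neg, mul_neg, neg_neg, Finset.sum_mul,
      mul_assoc]
    rw [intervalIntegral.integral_finsetSum
      fun i _ => Continuous.intervalIntegrable (by fun_prop) _ _, Finset.mul_sum]
    refine Finset.sum_congr rfl fun i _ => ?_
    rw [intervalIntegral.integral_const_mul, h1]
    ring
  have hsplit : ∫ x in (0 : ℝ)..1, (M.eval x * w x + lowerOp F G w x + upperOp F G w x)
        * (a.eval x * w'' x + b.eval x * w' x + c.eval x * w x + ℓ x * w 1)
      = (∫ x in (0 : ℝ)..1, M.eval x * w x * (a.eval x * w'' x + b.eval x * w' x + c.eval x * w x))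
        + (∫ x in (0 : ℝ)..1, (lowerOp F G w x + upperOp F G w x)
          * (a.eval x * w'' x + b.eval x * w' x + c.eval x * w x))
        + w 1 * ∫ x in (0 : ℝ)..1, (M.eval x * w x + lowerOp F G w x + upperOp F G w x) * ℓ x := by
    rw [← intervalIntegral.integral_const_mul,
      ← intervalIntegral.integral_add (Continuous.intervalIntegrable (by fun_prop) _ _)
      (Continuous.intervalIntegrable (by fun_prop) _ _),
      ← intervalIntegral.integral_add (Continuous.intervalIntegrable (by fun_prop) _ _)
      (Continuous.intervalIntegrable (by fun_prop) _ _)]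
    exact intervalIntegral.integral_congr fun x _ => by ring
  have htri : triForm (OmegaK₁ (fun x => a.eval x) (fun x => b.eval x) (fun x => c.eval x) K₁) w
      = (∫ x in (0 : ℝ)..1, w x * lowerOp (fun i => adjointPoly a b c (F i)) G w x)
        + ∫ x in (0 : ℝ)..1, w x * lowerOp F (fun i => adjointPoly a b c (G i)) w x := by
    rw [triForm_congr (OmegaK₁_eq a b c hK),
      triForm_add (continuous_separable fun _ _ => rfl) (continuous_separable fun _ _ => rfl) hw,
      triForm_eq_integral_lowerOp (fun _ _ => rfl) hw,
      triForm_eq_integral_lowerOp (fun _ _ => rfl) hw]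
  have hOM : ∫ x in (0 : ℝ)..1, OmegaM (fun x => a.eval x) (fun x => b.eval x)
        (fun x => c.eval x) α ε (fun x => M.eval x) K₁ K₂ x * w x ^ 2
      = (∫ x in (0 : ℝ)..1, ((a * M).derivative.derivative.eval x - (b * M).derivative.eval x
            + 2 * (M.eval x * c.eval x)) * w x ^ 2)
        + 2 * (∫ x in (0 : ℝ)..1, (jumpPoly a F G).eval x * w x ^ 2)
        - Real.pi ^ 2 / 2 * α * ε * ∫ x in (0 : ℝ)..1, w x ^ 2 := by
    rw [← intervalIntegral.integral_const_mul, ← intervalIntegral.integral_const_mul,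
      ← intervalIntegral.integral_add (Continuous.intervalIntegrable (by fun_prop) _ _)
      (Continuous.intervalIntegrable (by fun_prop) _ _),
      ← intervalIntegral.integral_sub (Continuous.intervalIntegrable (by fun_prop) _ _)
      (Continuous.intervalIntegrable (by fun_prop) _ _)]
    refine intervalIntegral.integral_congr fun x _ => ?_
    simp only [OmegaM_eq a b c M hK hK₂]
    ring
  -- Origin of the constant in `OmegaM`: -2∫aM w'² ≤ -2αε∫w'² ≤ -(π²/2)αε∫w².
  have hW := wirtinger hw hw' hd h0
  have hcoer : α * ε * ∫ x in (0 : ℝ)..1, w' x ^ 2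
      ≤ ∫ x in (0 : ℝ)..1, a.eval x * M.eval x * w' x ^ 2 := by
    rw [← intervalIntegral.integral_const_mul]
    refine intervalIntegral.integral_mono_on zero_le_one
      (Continuous.intervalIntegrable (by fun_prop) _ _)
      (Continuous.intervalIntegrable (by fun_prop) _ _) fun x hx => ?_
    exact mul_le_mul_of_nonneg_right
      (mul_le_mul (ha x hx) (hMε x) hε.le (hα.le.trans (ha x hx))) (sq_nonneg _)
  have hbd' := mul_nonpos_of_nonpos_of_nonneg hbd (sq_nonneg (w 1))
  have hW' := mul_le_mul_of_nonneg_left hW (mul_pos hα hε).le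
  unfold quadForm
  rw [htri, hOM, hsplit, hker, hgw, hinj]
  rw [h1] at hmult
  linarith

end Omega

/-! ### Evolution of the Lyapunov functional -/

theorem hasDerivAt_integral_of_continuous {f f' : ℝ → ℝ → ℝ}
    (hf : Continuous (Function.uncurry f)) (hf' : Continuous (Function.uncurry f'))
    (hd : ∀ s x, HasDerivAt (fun s => f s x) (f' s x) s) (a b s : ℝ) :
    HasDerivAt (fun s => ∫ x in a..b, f s x) (∫ x in a..b, f' s x) s := by
  obtain ⟨B, hB⟩ := ((isCompact_closedBall s 1).prod
    (isCompact_uIcc (a := a) (b := b))).exists_bound_of_continuousOn hf'.continuousOn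
  have c : ∀ s, Continuous (f s) := fun s => hf.uncurry_left s
  have c' : ∀ s, Continuous (f' s) := fun s => hf'.uncurry_left s
  refine (intervalIntegral.hasDerivAt_integral_of_dominated_loc_of_deriv_le
    (bound := fun _ => B) (Metric.closedBall_mem_nhds s one_pos)
    (Eventually.of_forall fun s => (c s).aestronglyMeasurable) ((c s).intervalIntegrable _ _)
    (c' s).aestronglyMeasurable (ae_of_all _ fun x hx σ hσ => ?_)
    (by simp) (ae_of_all _ fun x _ σ _ => hd σ x)).2
  exact hB (σ, x) ⟨hσ, uIoc_subset_uIcc hx⟩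

section Lyapunov

variable {r : ℕ} {F G : Fin r → ℝ[X]} {E E' : ℝ → ℝ → ℝ}

theorem continuous_lowerOp_uncurry (hE : Continuous (Function.uncurry E)) :
    Continuous fun p : ℝ × ℝ => lowerOp F G (E p.1) p.2 := by
  refine continuous_finsetSum _ fun i _ => ((F i).continuous.comp continuous_snd).mul ?_
  refine intervalIntegral.continuous_parametric_intervalIntegral_of_continuous
    (f := fun (p : ℝ × ℝ) ξ => (G i).eval ξ * E p.1 ξ) ?_ continuous_snd
  have h : Continuous fun q : (ℝ × ℝ) × ℝ => Function.uncurry E (q.1.1, q.2) := by fun_prop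
  exact ((G i).continuous.comp continuous_snd).mul h

theorem hasDerivAt_lowerOp_param (hE : Continuous (Function.uncurry E))
    (hE' : Continuous (Function.uncurry E'))
    (hd : ∀ s x, HasDerivAt (fun s => E s x) (E' s x) s) (s x : ℝ) :
    HasDerivAt (fun s => lowerOp F G (E s) x) (lowerOp F G (E' s) x) s := by
  refine HasDerivAt.fun_sum fun i _ => HasDerivAt.const_mul _ ?_
  exact hasDerivAt_integral_of_continuous (f := fun s ξ => (G i).eval ξ * E s ξ)
    (f' := fun s ξ => (G i).eval ξ * E' s ξ)
    (((G i).continuous.comp continuous_snd).mul hE)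
    (((G i).continuous.comp continuous_snd).mul hE') (fun s ξ => (hd s ξ).const_mul _) 0 x s

/-- Differentiating the triangular form gives two terms; adjointness turns one into the upper part
of 𝒳E, so the derivative is 2⟨𝒳E, E'⟩. -/
theorem hasDerivAt_quadForm {M : ℝ → ℝ} (hM : Continuous M) {K : ℝ → ℝ → ℝ}
    (hK : ∀ x ξ, K x ξ = ∑ i, (F i).eval x * (G i).eval ξ)
    (hE : Continuous (Function.uncurry E)) (hE' : Continuous (Function.uncurry E'))
    (hd : ∀ s x, HasDerivAt (fun s => E s x) (E' s x) s) (s : ℝ) :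
    HasDerivAt (fun s => quadForm M K (E s)) (2 * ∫ x in (0 : ℝ)..1,
      (M x * E s x + lowerOp F G (E s) x + upperOp F G (E s) x) * E' s x) s := by
  have hM2 : Continuous fun p : ℝ × ℝ => M p.2 := hM.comp continuous_snd
  have hE2 : Continuous fun p : ℝ × ℝ => E p.1 p.2 := hE
  have hl := continuous_lowerOp_uncurry (F := F) (G := G) hE
  have hl' := continuous_lowerOp_uncurry (F := F) (G := G) hE'
  have cE : Continuous (E s) := hE.uncurry_left s
  have cE' : Continuous (E' s) := hE'.uncurry_left s
  have cl := continuous_lowerOp (F := F) (G := G) cE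
  have cl' := continuous_lowerOp (F := F) (G := G) cE'
  have cu := continuous_upperOp (F := F) (G := G) cE
  have h1 := hasDerivAt_integral_of_continuous (f := fun s x => M x * E s x ^ 2)
    (f' := fun s x => M x * (2 * E s x * E' s x))
    (by simp only [Function.uncurry_def]; fun_prop) (hM2.mul ((continuous_const.mul hE).mul hE'))
    (fun s x => by simpa using ((hd s x).pow 2).const_mul (M x)) 0 1 s
  have h2 := hasDerivAt_integral_of_continuous (f := fun s x => E s x * lowerOp F G (E s) x)
    (f' := fun s x => E' s x * lowerOp F G (E s) x + E s x * lowerOp F G (E' s) x)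
    (hE.mul hl) ((hE'.mul hl).add (hE.mul hl'))
    (fun s x => (hd s x).mul (hasDerivAt_lowerOp_param hE hE' hd s x)) 0 1 s
  have e : (fun s => quadForm M K (E s)) = fun s => (∫ x in (0 : ℝ)..1, M x * E s x ^ 2)
      + 2 * ∫ x in (0 : ℝ)..1, E s x * lowerOp F G (E s) x := by
    ext s
    rw [quadForm, triForm_eq_integral_lowerOp hK (hE.uncurry_left s)]
  rw [e]
  refine (h1.add (h2.const_mul 2)).congr_deriv ?_
  have hadj := integral_mul_upperOp (F := F) (G := G) cE' cE
  rw [intervalIntegral.integral_add (Continuous.intervalIntegrable (by fun_prop) _ _)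
    (Continuous.intervalIntegrable (by fun_prop) _ _), ← hadj,
    ← intervalIntegral.integral_add (Continuous.intervalIntegrable (by fun_prop) _ _)
    (Continuous.intervalIntegrable (by fun_prop) _ _), ← intervalIntegral.integral_const_mul,
    ← intervalIntegral.integral_const_mul,
    ← intervalIntegral.integral_add (Continuous.intervalIntegrable (by fun_prop) _ _)
    (Continuous.intervalIntegrable (by fun_prop) _ _)]
  exact intervalIntegral.integral_congr fun x _ => by ring

theorem exists_quadForm_le {M : ℝ → ℝ} (hM : Continuous M) {K : ℝ → ℝ → ℝ}
    (hK : Continuous (Function.uncurry K)) :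
    ∃ C > 0, ∀ w : ℝ → ℝ, Continuous w → quadForm M K w ≤ C * ∫ x in (0 : ℝ)..1, w x ^ 2 := by
  obtain ⟨A, hA⟩ := isCompact_Icc.exists_bound_of_continuousOn
    (hM.continuousOn (s := Icc (0 : ℝ) 1))
  obtain ⟨B, hB⟩ := ((isCompact_Icc (a := (0 : ℝ)) (b := 1)).prod
    (isCompact_Icc (a := (0 : ℝ)) (b := 1))).exists_bound_of_continuousOn hK.continuousOn
  have m0 : (0 : ℝ) ∈ Icc (0 : ℝ) 1 := ⟨le_rfl, zero_le_one⟩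
  have hA0 : 0 ≤ A := (norm_nonneg _).trans (hA 0 m0)
  have hB0 : 0 ≤ B := (norm_nonneg _).trans (hB (0, 0) ⟨m0, m0⟩)
  -- The triangular form is at most B‖w‖² and enters twice; the 1 makes the constant positive.
  refine ⟨A + 2 * B + 1, by positivity, fun w hw => ?_⟩
  set I := ∫ x in (0 : ℝ)..1, w x ^ 2 with hI
  have hI0 : 0 ≤ I := intervalIntegral.integral_nonneg zero_le_one fun x _ => sq_nonneg _
  have h1 : ∫ x in (0 : ℝ)..1, M x * w x ^ 2 ≤ A * I := by
    rw [hI, ← intervalIntegral.integral_const_mul]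
    refine intervalIntegral.integral_mono_on zero_le_one
      (Continuous.intervalIntegrable (by fun_prop) _ _)
      (Continuous.intervalIntegrable (by fun_prop) _ _) fun x hx => ?_
    exact mul_le_mul_of_nonneg_right ((le_abs_self _).trans (hA x hx)) (sq_nonneg _)
  have h2 : triForm K w ≤ ∫ x in (0 : ℝ)..1, (B / 2 * w x ^ 2 + B / 2 * I) := by
    have ci := continuous_inner hK hw
    refine intervalIntegral.integral_mono_on zero_le_one
      (Continuous.intervalIntegrable (by fun_prop) _ _)
      (Continuous.intervalIntegrable (by fun_prop) _ _) fun x hx => ?_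
    have cK : Continuous fun ξ => K x ξ := hK.uncurry_left x
    calc w x * ∫ ξ in (0 : ℝ)..x, K x ξ * w ξ = ∫ ξ in (0 : ℝ)..x, w x * (K x ξ * w ξ) := by
          rw [intervalIntegral.integral_const_mul]
      _ ≤ ∫ ξ in (0 : ℝ)..x, (B / 2 * w x ^ 2 + B / 2 * w ξ ^ 2) := by
          refine intervalIntegral.integral_mono_on hx.1
            (Continuous.intervalIntegrable (by fun_prop) _ _)
            (Continuous.intervalIntegrable (by fun_prop) _ _) fun ξ hξ => ?_
          have hk := abs_le.1 (hB (x, ξ) ⟨hx, hξ.1, hξ.2.trans hx.2⟩)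
          simp only [Function.uncurry_apply_pair] at hk
          -- The sum of (B - K)(w(x) + w(ξ))² and (B + K)(w(x) - w(ξ))² is 2B(w(x)² + w(ξ)²) - 4K
          -- w(x)w(ξ).
          nlinarith [mul_nonneg (sub_nonneg.2 hk.2) (sq_nonneg (w x + w ξ)),
            mul_nonneg (sub_nonneg.2 hk.1) (sq_nonneg (w x - w ξ))]
      _ = x * (B / 2 * w x ^ 2) + B / 2 * ∫ ξ in (0 : ℝ)..x, w ξ ^ 2 := by
          rw [intervalIntegral.integral_add (Continuous.intervalIntegrable (by fun_prop) _ _)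
            (Continuous.intervalIntegrable (by fun_prop) _ _)]
          simp only [intervalIntegral.integral_const_mul, intervalIntegral.integral_const, sub_zero,
            smul_eq_mul]
          ring
      _ ≤ B / 2 * w x ^ 2 + B / 2 * I := by
          refine add_le_add (mul_le_of_le_one_left (by positivity) hx.2) ?_
          refine mul_le_mul_of_nonneg_left ?_ (by positivity)
          exact intervalIntegral.integral_mono_interval le_rfl hx.1 hx.2
            (ae_of_all _ fun ξ => sq_nonneg (w ξ))
            (Continuous.intervalIntegrable (by fun_prop) _ _)
  rw [intervalIntegral.integral_add (Continuous.intervalIntegrable (by fun_prop) _ _)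
    (Continuous.intervalIntegrable (by fun_prop) _ _), intervalIntegral.integral_const_mul] at h2
  simp only [← hI, intervalIntegral.integral_const, sub_zero, one_smul] at h2
  unfold quadForm
  linarith

end Lyapunov

/-! ### Norms -/

theorem l2norm_sq (w : ℝ → ℝ) : l2norm w ^ 2 = ∫ x in (0 : ℝ)..1, w x ^ 2 :=
  Real.sq_sqrt (intervalIntegral.integral_nonneg zero_le_one fun _ _ => sq_nonneg _)

theorem l2norm_sq_le_of_sub {u v : ℝ → ℝ} (hu : ContinuousOn u (Icc 0 1))
    (hv : ContinuousOn v (Icc 0 1)) :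
    l2norm u ^ 2 ≤ 2 * l2norm (fun x => u x - v x) ^ 2 + 2 * l2norm v ^ 2 := by
  simp only [l2norm_sq]
  rw [← intervalIntegral.integral_const_mul, ← intervalIntegral.integral_const_mul,
    ← intervalIntegral.integral_add]
  · refine intervalIntegral.integral_mono_on zero_le_one ?_ ?_ fun x _ => ?_
    · exact ContinuousOn.intervalIntegrable_of_Icc zero_le_one (by fun_prop)
    · exact ContinuousOn.intervalIntegrable_of_Icc zero_le_one (by fun_prop)
    · nlinarith [sq_nonneg (u x - 2 * v x)]
  · exact ContinuousOn.intervalIntegrable_of_Icc zero_le_one (by fun_prop)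
  · exact ContinuousOn.intervalIntegrable_of_Icc zero_le_one (by fun_prop)

theorem integral_comp_clamp_sq (w : ℝ → ℝ) :
    ∫ x in (0 : ℝ)..1, w (clamp x) ^ 2 = l2norm w ^ 2 := by
  rw [l2norm_sq]
  refine intervalIntegral.integral_congr fun x hx => ?_
  rw [uIcc_of_le zero_le_one] at hx
  simp only [clamp_of_mem hx]

/-- The clamped extension may have a kink at 0 or 1, which is why the integrations by parts ask for
derivatives only in the open interval. -/
theorem hasDerivAt_comp_clamp {f f' : ℝ → ℝ}
    (h : ∀ x ∈ Icc (0 : ℝ) 1, HasDerivWithinAt f (f' x) (Icc 0 1) x) :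
    ∀ x ∈ Ioo (0 : ℝ) 1, HasDerivAt (fun y => f (clamp y)) (f' (clamp x)) x := by
  intro x hx
  have hx' : x ∈ Icc (0 : ℝ) 1 := Ioo_subset_Icc_self hx
  have hn : Icc (0 : ℝ) 1 ∈ 𝓝 x := Icc_mem_nhds hx.1 hx.2
  rw [clamp_of_mem hx']
  refine ((h x hx').hasDerivAt hn).congr_of_eventuallyEq ?_
  filter_upwards [hn] with y hy
  rw [clamp_of_mem hy]

/-- A quadratic functional comparable with the squared norm which decays at rate `2δ` along the
trajectories yields exponential decay of the norm. -/
theorem decay_of_lyapunov {ε δ C : ℝ} (hε : 0 < ε) (hC : 0 < C) {e : ℝ → ℝ → ℝ} {V : ℝ → ℝ}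
    (hlow : ∀ t > 0, ε * l2norm (e t) ^ 2 ≤ V t) (hup : ∀ t > 0, V t ≤ C * l2norm (e t) ^ 2)
    (hV : ∀ τ t, 0 < τ → τ ≤ t →
      V t * Real.exp (2 * δ * t) ≤ V τ * Real.exp (2 * δ * τ))
    (hc : ∀ t > 0, ContinuousOn (e t) (Icc 0 1)) (hc0 : ContinuousOn (e 0) (Icc 0 1))
    (h0 : Tendsto (fun t => l2norm (fun x => e t x - e 0 x)) (𝓝[>] 0) (𝓝 0)) {t : ℝ} (ht : 0 < t) :
    l2norm (e t) ≤ Real.sqrt (2 * C / ε) * l2norm (e 0) * Real.exp (-δ * t) := by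
  -- The equation holds only for t > 0 and the initial value is attained only in L₂. So V is
  -- compared between τ and t, and τ tends to 0 in the bound by norms; the factor 2 comes from
  -- `l2norm_sq_le_of_sub`.
  have hlim : Tendsto (fun τ => C * (2 * l2norm (fun x => e τ x - e 0 x) ^ 2 + 2 * l2norm (e 0) ^ 2)
      * Real.exp (2 * δ * τ)) (𝓝[>] 0)
      (𝓝 (C * (2 * 0 ^ 2 + 2 * l2norm (e 0) ^ 2) * Real.exp (2 * δ * 0))) := by
    refine (((h0.pow 2).const_mul 2).add_const _ |>.const_mul C).mul ?_
    refine Tendsto.mono_left (ContinuousAt.tendsto ?_) nhdsWithin_le_nhds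
    fun_prop
  have hle : ε * l2norm (e t) ^ 2 * Real.exp (2 * δ * t)
      ≤ C * (2 * 0 ^ 2 + 2 * l2norm (e 0) ^ 2) * Real.exp (2 * δ * 0) := by
    refine ge_of_tendsto hlim ?_
    filter_upwards [Ioc_mem_nhdsGT ht] with τ hτ
    calc ε * l2norm (e t) ^ 2 * Real.exp (2 * δ * t) ≤ V t * Real.exp (2 * δ * t) := by
          gcongr; exact hlow t ht
      _ ≤ V τ * Real.exp (2 * δ * τ) := hV τ t hτ.1 hτ.2
      _ ≤ _ := by
          refine mul_le_mul_of_nonneg_right ((hup τ hτ.1).trans ?_) (Real.exp_pos _).le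
          exact mul_le_mul_of_nonneg_left (l2norm_sq_le_of_sub (hc τ hτ.1) hc0) hC.le
  have hn : ∀ w, 0 ≤ l2norm w := fun w => Real.sqrt_nonneg _
  have hexp : Real.exp (-δ * t) ^ 2 = (Real.exp (2 * δ * t))⁻¹ := by
    rw [← Real.exp_nat_mul, ← Real.exp_neg]
    congr 1
    push_cast
    ring
  refine (pow_le_pow_iff_left₀ (hn _)
    (mul_nonneg (mul_nonneg (Real.sqrt_nonneg _) (hn _)) (Real.exp_pos _).le) two_ne_zero).1 ?_
  rw [mul_pow, mul_pow, Real.sq_sqrt (by positivity), hexp, ← div_eq_mul_inv,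
    le_div_iff₀ (Real.exp_pos _), div_mul_eq_mul_div, le_div_iff₀ hε]
  simp only [mul_zero, Real.exp_zero, mul_one] at hle
  linarith

/-! ### Decay of the estimation error -/

/-- Dissipation together with `hneg` gives V' ≤ -2δV, so V(t)exp(2δt) has nonpositive derivative. -/
theorem lyapunov_antitone {r : ℕ} {F G : Fin r → ℝ[X]} {K₁ K₂ : ℝ → ℝ → ℝ} {a b c M : ℝ[X]}
    {α ε δ L₂ : ℝ} (hα : 0 < α) (hε : 0 < ε)
    (ha : ∀ x ∈ Icc (0 : ℝ) 1, α ≤ a.eval x) (hMε : ∀ x, ε ≤ M.eval x)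
    (hK : ∀ x ξ, K₁ x ξ = ∑ i, (F i).eval x * (G i).eval ξ) (hK₂ : ∀ x ξ, K₂ x ξ = K₁ ξ x)
    (hK0 : ∀ ξ, K₂ 0 ξ = 0)
    (hbd : 2 * (a.eval 1 * M.eval 1) * L₂ + ((b * M).eval 1 - (a * M).derivative.eval 1) ≤ 0)
    {ℓ g L₁ : ℝ → ℝ} (hℓ : Continuous ℓ) (hL₁ : ∀ x ∈ Icc (0 : ℝ) 1, L₁ x = ℓ x)
    (hℓg : ∀ x ∈ Icc (0 : ℝ) 1, M.eval x * ℓ x + lowerOp F G ℓ x + upperOp F G ℓ x = g x)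
    (hg : ∀ ξ, g ξ = -∑ i, (a.eval 1 * (F i).eval 1 * L₂ - (a * F i).derivative.eval 1
      + b.eval 1 * (F i).eval 1) * (G i).eval ξ)
    (hneg : ∀ w : ℝ → ℝ, Continuous w →
      quadForm (OmegaM (fun x => a.eval x) (fun x => b.eval x) (fun x => c.eval x) α ε
          (fun x => M.eval x) K₁ K₂)
        (OmegaK₁ (fun x => a.eval x) (fun x => b.eval x) (fun x => c.eval x) K₁) w
      ≤ -(2 * δ) * quadForm (fun x => M.eval x) K₁ w)
    {e : ℝ → ℝ → ℝ}
    (he : IsErrorSolution (fun x => a.eval x) (fun x => b.eval x) (fun x => c.eval x) L₁ L₂ e)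
    {τ t : ℝ} (hτ : 0 < τ) (hτt : τ ≤ t) :
    quadForm (fun x => M.eval x) K₁ (fun x => e t (clamp x)) * Real.exp (2 * δ * t)
      ≤ quadForm (fun x => M.eval x) K₁ (fun x => e τ (clamp x)) * Real.exp (2 * δ * τ) := by
  obtain ⟨⟨et, ex, exx, ce, cet, cex, cexx, heq, hbc⟩, -⟩ := he
  -- time is reparametrized by `t = exp s`, which makes everything continuous on the plane
  have hmap : Continuous fun p : ℝ × ℝ => (Real.exp p.1, clamp p.2) :=
    (Real.continuous_exp.comp continuous_fst).prodMk (continuous_clamp.comp continuous_snd)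
  have hmem : ∀ p : ℝ × ℝ, (Real.exp p.1, clamp p.2) ∈ Ioi (0 : ℝ) ×ˢ Icc (0 : ℝ) 1 :=
    fun p => ⟨Real.exp_pos _, clamp_mem _⟩
  let E : ℝ → ℝ → ℝ := fun s x => e (Real.exp s) (clamp x)
  let E' : ℝ → ℝ → ℝ := fun s x => et (Real.exp s) (clamp x) * Real.exp s
  have hE : Continuous (Function.uncurry E) := ce.comp_continuous hmap hmem
  have hE' : Continuous (Function.uncurry E') :=
    (cet.comp_continuous hmap hmem).mul (Real.continuous_exp.comp continuous_fst)
  have hEd : ∀ s x, HasDerivAt (fun s => E s x) (E' s x) s := fun s x =>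
    ((heq _ (Real.exp_pos s) _ (clamp_mem x)).1).comp s (Real.hasDerivAt_exp s)
  let W : ℝ → ℝ := fun s => quadForm (fun x => M.eval x) K₁ (E s)
  have hW := hasDerivAt_quadForm M.continuous hK hE hE' hEd
  have hWle : ∀ s, 2 * ∫ x in (0 : ℝ)..1,
      (M.eval x * E s x + lowerOp F G (E s) x + upperOp F G (E s) x) * E' s x
      ≤ Real.exp s * (-(2 * δ) * W s) := by
    intro s
    have hpos := Real.exp_pos s
    have cw : Continuous (E s) := hE.uncurry_left s
    have cw' : Continuous fun x => ex (Real.exp s) (clamp x) :=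
      (cex.comp_continuous hmap hmem).comp (Continuous.prodMk_right s)
    have cw'' : Continuous fun x => exx (Real.exp s) (clamp x) :=
      (cexx.comp_continuous hmap hmem).comp (Continuous.prodMk_right s)
    have m0 : (0 : ℝ) ∈ Icc (0 : ℝ) 1 := ⟨le_rfl, zero_le_one⟩
    have m1 : (1 : ℝ) ∈ Icc (0 : ℝ) 1 := ⟨zero_le_one, le_rfl⟩
    have h := dissipation_inequality a b c M hα hε ha hMε hK hK₂ hK0 hbd hℓ hℓg hg cw cw' cw''
      (hasDerivAt_comp_clamp fun x hx => (heq _ hpos x hx).2.1)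
      (hasDerivAt_comp_clamp fun x hx => (heq _ hpos x hx).2.2.1)
      (by simp only [E, clamp_of_mem m0]; exact (hbc _ hpos).1)
      (by simp only [E, clamp_of_mem m1]; exact (hbc _ hpos).2)
    -- The factor exp s is the chain rule factor contained in `E'`.
    have h' := mul_le_mul_of_nonneg_left (h.trans (hneg _ cw)) hpos.le
    refine le_trans (le_of_eq ?_) h'
    rw [mul_left_comm, ← intervalIntegral.integral_const_mul (Real.exp s)]
    congr 1
    refine intervalIntegral.integral_congr fun x hx => ?_
    rw [uIcc_of_le zero_le_one] at hx
    simp only [E, E', clamp_of_mem hx, clamp_of_mem m1, (heq _ hpos x hx).2.2.2, hL₁ x hx]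
    ring
  have hY : ∀ s, HasDerivAt (fun s => W s * Real.exp (2 * δ * Real.exp s))
      ((2 * ∫ x in (0 : ℝ)..1,
        (M.eval x * E s x + lowerOp F G (E s) x + upperOp F G (E s) x) * E' s x)
          * Real.exp (2 * δ * Real.exp s)
        + W s * (Real.exp (2 * δ * Real.exp s) * (2 * δ * Real.exp s))) s := fun s =>
    (hW s).mul (((Real.hasDerivAt_exp s).const_mul (2 * δ)).exp)
  have hanti : Antitone fun s => W s * Real.exp (2 * δ * Real.exp s) := by
    refine antitone_of_deriv_nonpos (fun s => (hY s).differentiableAt) fun s => ?_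
    rw [(hY s).deriv]
    have h := mul_le_mul_of_nonneg_right (hWle s) (Real.exp_pos (2 * δ * Real.exp s)).le
    linarith
  have h := hanti (Real.log_le_log hτ hτt)
  simpa only [W, E, Real.exp_log hτ, Real.exp_log (hτ.trans_le hτt)] using h

end ObserverSynthesis

/-! ### Exponential decay of the observer error -/

theorem theorem5
    (a b c : ℝ[X]) (α : ℝ) (hα : 0 < α) (ha : ∀ x ∈ Icc (0 : ℝ) 1, α ≤ a.eval x)
    (ε δ : ℝ) (hε : 0 < ε) (hδ : 0 < δ) (d₁ d₂ d₁' d₂' : ℕ)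
    (M : ℝ[X]) (K₁ K₂ : MvPolynomial (Fin 2) ℝ)
    (hM : InXi d₁ d₂ ε (fun x => M.eval x) (ev₂ K₁) (ev₂ K₂))
    (hK₂ : ∀ x, ev₂ K₂ 0 x = 0)
    (hΩ : InXi d₁' d₂' 0
      (fun x => -OmegaM (fun x => a.eval x) (fun x => b.eval x) (fun x => c.eval x) α ε
          (fun x => M.eval x) (ev₂ K₁) (ev₂ K₂) x - 2 * δ * M.eval x)
      (fun x ξ => -OmegaK₁ (fun x => a.eval x) (fun x => b.eval x) (fun x => c.eval x)
          (ev₂ K₁) x ξ - 2 * δ * ev₂ K₁ x ξ)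
      (fun x ξ => -OmegaK₂ (fun x => a.eval x) (fun x => b.eval x) (fun x => c.eval x)
          (ev₂ K₁) x ξ - 2 * δ * ev₂ K₂ x ξ))
    (r : ℕ) (F G : Fin r → ℝ[X])
    (hFG : ∀ x ξ, ev₂ K₁ x ξ = ∑ i, (F i).eval x * (G i).eval ξ)
    (T₂ L₂ : ℝ) (T₁ T₃ L₁ : ℝ → ℝ)
    (hT₁ : ∀ x, T₁ x = -((b.eval 1 - a.derivative.eval 1) * ev₂ K₁ 1 x
      - a.eval 1 * deriv (fun y => ev₂ K₁ y x) 1))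
    (hT₂ : T₂ < -(1 / 2) * ((b.eval 1 - a.derivative.eval 1) * M.eval 1
      - a.eval 1 * M.derivative.eval 1))
    (hL₂ : L₂ = (a.eval 1 * M.eval 1)⁻¹ * T₂)
    (hT₃ : ∀ x, T₃ x = -L₂ * a.eval 1 * ev₂ K₁ 1 x)
    (hL₁ : ∀ x, L₁ x = opX (invM fun x => M.eval x) (invK₁ (fun x => M.eval x) F G)
      (invK₂ (fun x => M.eval x) F G) (fun ξ => T₁ ξ + T₃ ξ) x) :
    ∃ γ > 0, ∀ e : ℝ → ℝ → ℝ,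
      IsErrorSolution (fun x => a.eval x) (fun x => b.eval x) (fun x => c.eval x) L₁ L₂ e →
      InDe L₂ (e 0) →
      ∀ t > 0, l2norm (e t) ≤ γ * l2norm (e 0) * Real.exp (-δ * t) := by
  set K : ℝ → ℝ → ℝ := ev₂ K₁ with hKdef
  have hsymm : ∀ x ξ, ev₂ K₂ x ξ = K ξ x := by
    obtain ⟨_, _, _, _, _, _, _, _, _, h⟩ := hM
    exact h
  have hMε : ∀ x, ε ≤ M.eval x := hM.le_multiplier
  have hMpos : ∀ x, 0 < M.eval x := fun x => hε.trans_le (hMε x)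
  have ha1 : 0 < a.eval 1 := hα.trans_le (ha 1 ⟨zero_le_one, le_rfl⟩)
  have hKc := continuous_separable hFG
  -- the injection gain
  have hKd : ∀ x, deriv (fun y => K y x) 1 = ∑ i, (F i).derivative.eval 1 * (G i).eval x := by
    intro x
    have e : (fun y => K y x) = fun y => (∑ i, F i * C ((G i).eval x)).eval y := by
      ext y
      simp [hFG, Polynomial.eval_finsetSum]
    rw [e, Polynomial.deriv]
    simp only [Polynomial.derivative_sum, derivative_mul_C, Polynomial.eval_finsetSum, eval_mul_C]
  -- T₁ collects the part of the boundary functional proportional to w(1), T₃ the part from w'(1) =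
  -- L₂w(1).
  have hg : ∀ ξ, T₁ ξ + T₃ ξ = -∑ i, (a.eval 1 * (F i).eval 1 * L₂
      - (a * F i).derivative.eval 1 + b.eval 1 * (F i).eval 1) * (G i).eval ξ := by
    intro ξ
    rw [hT₁, hT₃, hKd, hFG]
    simp only [Polynomial.derivative_mul, Polynomial.eval_add, Polynomial.eval_mul, Finset.mul_sum,
      ← Finset.sum_sub_distrib, ← Finset.sum_neg_distrib, ← Finset.sum_add_distrib]
    exact Finset.sum_congr rfl fun i _ => by ring
  have hgc : Continuous fun ξ => T₁ ξ + T₃ ξ := by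
    rw [funext hg]
    exact (continuous_finsetSum _ fun i _ => (G i).continuous.const_mul _).neg
  -- Coercivity gives injectivity: 𝒳w = 0 implies ε‖w‖² ≤ ⟨w, 𝒳w⟩ = 0.
  have hinj : ∀ w : ℝ → ℝ, Continuous w →
      (∀ x ∈ Icc (0 : ℝ) 1, M.eval x * w x + lowerOp F G w x + upperOp F G w x = 0) →
      ∀ x ∈ Icc (0 : ℝ) 1, w x = 0 := by
    intro w hw h
    refine eq_zero_of_integral_sq_nonpos hw ?_
    have h1 := hM.le_quadForm hw
    have h2 : ∫ x in (0 : ℝ)..1, w x * (M.eval x * w x + lowerOp F G w x + upperOp F G w x)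
        = ∫ _ in (0 : ℝ)..1, (0 : ℝ) := intervalIntegral.integral_congr fun x hx => by
      rw [uIcc_of_le zero_le_one] at hx
      simp only [h x hx, mul_zero]
    rw [quadForm_eq_integral M.continuous hFG hw, h2, intervalIntegral.integral_zero] at h1
    exact nonpos_of_mul_nonpos_right h1 hε
  obtain ⟨ℓ, hℓ, hℓL, hℓg⟩ := opX_inverse M.continuous (fun x _ => (hMpos x).ne') hinj hgc
  -- The first term is 2T₂, so this is the hypothesis on T₂ doubled.
  have hbd : 2 * (a.eval 1 * M.eval 1) * L₂
      + ((b * M).eval 1 - (a * M).derivative.eval 1) ≤ 0 := by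
    rw [hL₂, mul_assoc, mul_inv_cancel_left₀ (mul_pos ha1 (hMpos 1)).ne']
    simp only [Polynomial.derivative_mul, Polynomial.eval_add, Polynomial.eval_mul]
    linarith
  have hneg : ∀ w : ℝ → ℝ, Continuous w →
      quadForm (OmegaM (fun x => a.eval x) (fun x => b.eval x) (fun x => c.eval x) α ε
          (fun x => M.eval x) K (ev₂ K₂))
        (OmegaK₁ (fun x => a.eval x) (fun x => b.eval x) (fun x => c.eval x) K) w
      ≤ -(2 * δ) * quadForm (fun x => M.eval x) K w := by
    intro w hw
    -- Membership in the cone with constant 0 makes the form of -Ω_s - 2δ𝒳 nonnegative; linearity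
    -- then separates the two forms.
    have h := hΩ.le_quadForm hw
    have hΩc := continuous_OmegaK₁ a b c hFG
    have cO : Continuous (OmegaM (fun x => a.eval x) (fun x => b.eval x) (fun x => c.eval x) α ε
        (fun x => M.eval x) K (ev₂ K₂)) := by
      rw [funext (OmegaM_eq a b c M hFG hsymm α ε)]
      have c1 := (a * M).derivative.derivative.continuous
      have c2 := (b * M).derivative.continuous
      have c3 := (jumpPoly a F G).continuous
      have c4 := M.continuous
      have c5 := c.continuous
      fun_prop
    have cM := M.continuous
    have e1 := triForm_add (w := w)
      (K := fun x ξ => -1 * OmegaK₁ (fun x => a.eval x) (fun x => b.eval x) (fun x => c.eval x) K x ξ)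
      (L := fun x ξ => -(2 * δ) * K x ξ) (hΩc.const_mul (-1)) (hKc.const_mul _) hw
    rw [triForm_smul _ hΩc hw, triForm_smul _ hKc hw] at e1
    have e2 : ∀ x ξ, -OmegaK₁ (fun x => a.eval x) (fun x => b.eval x) (fun x => c.eval x) K x ξ
        - 2 * δ * K x ξ
        = -1 * OmegaK₁ (fun x => a.eval x) (fun x => b.eval x) (fun x => c.eval x) K x ξ
          + -(2 * δ) * K x ξ := fun x ξ => by ring
    have e3 : ∫ x in (0 : ℝ)..1, (-OmegaM (fun x => a.eval x) (fun x => b.eval x)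
          (fun x => c.eval x) α ε (fun x => M.eval x) K (ev₂ K₂) x - 2 * δ * M.eval x) * w x ^ 2
        = -1 * (∫ x in (0 : ℝ)..1, OmegaM (fun x => a.eval x) (fun x => b.eval x)
            (fun x => c.eval x) α ε (fun x => M.eval x) K (ev₂ K₂) x * w x ^ 2)
          + -(2 * δ) * ∫ x in (0 : ℝ)..1, M.eval x * w x ^ 2 := by
      rw [← intervalIntegral.integral_const_mul, ← intervalIntegral.integral_const_mul,
        ← intervalIntegral.integral_add (Continuous.intervalIntegrable (by fun_prop) _ _)
        (Continuous.intervalIntegrable (by fun_prop) _ _)]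
      exact intervalIntegral.integral_congr fun x _ => by ring
    unfold quadForm at h ⊢
    rw [triForm_congr e2, e1, e3, zero_mul] at h
    linarith
  obtain ⟨C, hC, hCle⟩ := exists_quadForm_le M.continuous hKc
  refine ⟨Real.sqrt (2 * C / ε), Real.sqrt_pos.2 (by positivity), fun e he h0 t ht => ?_⟩
  obtain ⟨⟨_, _, _, ce, _, _, _, _, _⟩, hinit⟩ := id he
  have cet : ∀ t > 0, ContinuousOn (e t) (Icc 0 1) := fun t ht =>
    ce.comp (Continuous.prodMk_right t).continuousOn fun x hx => ⟨ht, hx⟩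
  have cet' : ∀ t > 0, Continuous fun x => e t (clamp x) := fun t ht =>
    continuous_comp_clamp (cet t ht)
  -- The domain 𝒟_e supplies a continuous initial value, so the squares in the comparison of e(τ)
  -- with e(0) are integrable.
  have hc0 : ContinuousOn (e 0) (Icc 0 1) := by
    obtain ⟨_, _, h, _⟩ := h0
    exact h
  refine decay_of_lyapunov (V := fun t => quadForm (fun x => M.eval x) K fun x => e t (clamp x))
    hε hC (fun t ht => ?_) (fun t ht => ?_) (fun τ t hτ hτt => ?_) cet hc0 hinit ht
  · rw [← integral_comp_clamp_sq]
    exact hM.le_quadForm (cet' t ht)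
  · rw [← integral_comp_clamp_sq]
    exact hCle _ (cet' t ht)
  · exact lyapunov_antitone hα hε ha hMε hFG hsymm hK₂ hbd hℓ
      (fun x hx => (hL₁ x).trans (hℓL x hx)) hℓg hg hneg he hτ hτt
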